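/- Let $V$ be a complex vector space with basis $\xi_i$, $i\in I=\{1,2,3,\dots\}$, and let $\Lambda(\infty)=\Lambda(V)$ be its Grassmann algebra, with the odd superderivations $\partial_i$ determined by $\partial_i(\xi_j)=\delta_{ij}$. Let $\mathfrak g=W(\infty)$ be the Lie superalgebra spanned by the operators $P\partial_i$ with $P\in\Lambda(\infty)$, $i\in I$, under the supercommutator. It is $\mathbb Z$-graded, $\mathfrak g=\bigoplus_{k\ge -1}\mathfrak g^k$ with $\mathfrak g^k=\operatorname{span}\{P\partial_i : P\in\Lambda^{k+1}(V)\}$, and elements of $\mathfrak g^k$ have parity $k$ mod $2$. Put $\mathfrak g^<=\mathfrak g^{-1}$ and $\mathfrak g^{\le}=\mathfrak g^{-1}\oplus\mathfrak g^0$, and identify $\mathfrak g^0$ with $\mathfrak{gl}(\infty)$ by $\xi_i\partial_j\mapsto E_{i,j}$. Let $\mathfrak t_n\subset\mathfrak g$ be the subalgebra generated by all $\xi_{i_1}\cdots\xi_{i_k}\partial_j$ ($k\ge 0$) with $j,i_1,\dots,i_k\ge n$, and let $\mathfrak t_n'\subset\mathfrak{gl}(\infty)$ be the subalgebra generated by all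 $E_{i,j}$ with $i,j\ge n$. A $\mathfrak{gl}(\infty)$-module $X$ is integrable if $\dim\operatorname{span}\{a^i x : i\ge 0\}<\infty$ for all $a\in\mathfrak{gl}(\infty)$, $x\in X$. Let $\mathbb T_{\mathfrak{gl}(\infty)}$ be the category of integrable $\mathfrak{gl}(\infty)$-modules of finite length in which every vector is annihilated by $\mathfrak t'_n$ for some $n$. Let $\mathbb T_W^{\le}$ be the category of ($\mathbb Z/2$-graded) $\mathfrak g$-modules $M$ such that: (1) $M$ has a $\mathbb Z$-grading $M=\bigoplus_{k\in\mathbb Z}M^k$ with $\mathfrak g^iM^j\subseteq M^{i+j}$, $M_{\bar 0}=\bigoplus_k M^{2k}$ and $M_{\bar 1}=\bigoplus_k M^{2k+1}$; (2) $M$ is integrable over $\mathfrak g^0$; (3) every vector of $M$ is annihilated by $\mathfrak t_n\cap\mathfrak g^{\le}$ for some $n$. For such $M$ let $\Psi(M)=M^{\mathfrak g^<}=\{m\in M : \mathfrak g^{-1}m=0\}$, a $\mathfrak g^0$-module. For a $\mathfrak{gl}(\infty)$-module $X$ let $K^-(X)=U(\mathfrak g)\otimes_{U(\mathfrak g^{\le})}X$,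 where $\mathfrak g^{-1}$ acts on $X$ by zero, and, for $X$ simple, let $L^-(X)$ be the unique simple quotient of $K^-(X)$, that is, its quotient by the sum of all proper submodules. **Proposition.** Let $M\in\mathbb T_W^{\le}$. (a) If $M\ne 0$, then $\Psi(M)\neq 0$. (b) If $M$ is a simple $\mathfrak g$-module, then (1) $\Psi(M)$ is a simple $\mathfrak g^0$-module, (2) $\Psi(M)$ lies in $\mathbb T_{\mathfrak{gl}(\infty)}$, and (3) $M\cong L^-(\Psi(M))$ as $\mathfrak g$-modules (by an isomorphism that preserves parity, where $\Psi(M)$ carries the $\mathbb Z/2$-grading inherited from $M$). -/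

import Mathlib

universe u

attribute [local instance] LieRing.ofAssociativeRing

open scoped TensorProduct

noncomputable section

namespace WInf

/-- The countable-dimensional space `V` with basis `ξ_i`; the index set is `ℕ`. -/
abbrev V : Type := ℕ →₀ ℂ

/-- The Grassmann algebra `Λ(∞) = Λ(V)`. -/
abbrev Gr : Type := ExteriorAlgebra ℂ V

/-- The odd generator `ξ_i` of `Λ(∞)`. -/
def xi (i : ℕ) : Gr := ExteriorAlgebra.ι ℂ (Finsupp.single i 1)

/-- The odd superderivation `∂_i` of `Λ(∞)` with `∂_i(ξ_j) = δ_{ij}`. -/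
def del (i : ℕ) : Module.End ℂ Gr :=
  CliffordAlgebra.contractLeft (Q := (0 : QuadraticForm ℂ V)) (Finsupp.lapply i)

/-- The grading involution of `Λ(∞)`: it is `(-1)^d` on the component of degree `d`. -/
def gam : Module.End ℂ Gr :=
  (CliffordAlgebra.involute (Q := (0 : QuadraticForm ℂ V))).toLinearMap

/-- The operator `P ∂_i` on `Λ(∞)`. -/
def fld (P : Gr) (i : ℕ) : Module.End ℂ Gr := LinearMap.mulLeft ℂ P ∘ₗ del i

@[simp] lemma fld_apply (P : Gr) (i : ℕ) (Q : Gr) : fld P i Q = P * del i Q := rfl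

lemma del_xi (i j : ℕ) : del i (xi j) = if i = j then 1 else 0 := by
  have h := CliffordAlgebra.contractLeft_ι (Q := (0 : QuadraticForm ℂ V))
    (Finsupp.lapply i) (Finsupp.single j 1)
  refine h.trans ?_
  by_cases hij : i = j
  · subst hij; simp
  · simp [hij]

lemma gam_gam (x : Gr) : gam (gam x) = x := CliffordAlgebra.involute_involute x

lemma gam_mul (x y : Gr) : gam (x * y) = gam x * gam y :=
  map_mul (CliffordAlgebra.involute (Q := (0 : QuadraticForm ℂ V))) x y

lemma gam_ι (v : V) : gam (ExteriorAlgebra.ι ℂ v) = -ExteriorAlgebra.ι ℂ v :=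
  CliffordAlgebra.involute_ι (Q := (0 : QuadraticForm ℂ V)) v

lemma gam_algebraMap (r : ℂ) : gam (algebraMap ℂ Gr r) = algebraMap ℂ Gr r :=
  (CliffordAlgebra.involute (Q := (0 : QuadraticForm ℂ V))).commutes r

lemma del_ι_mul (i : ℕ) (v : V) (x : Gr) :
    del i (ExteriorAlgebra.ι ℂ v * x) = v i • x - ExteriorAlgebra.ι ℂ v * del i x :=
  CliffordAlgebra.contractLeft_ι_mul (Q := (0 : QuadraticForm ℂ V)) (d := Finsupp.lapply i) v x

lemma del_algebraMap (i : ℕ) (r : ℂ) : del i (algebraMap ℂ Gr r) = 0 :=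
  CliffordAlgebra.contractLeft_algebraMap (Q := (0 : QuadraticForm ℂ V)) (d := Finsupp.lapply i) r

lemma del_comm (i j : ℕ) (x : Gr) : del i (del j x) = -del j (del i x) :=
  CliffordAlgebra.contractLeft_comm (Q := (0 : QuadraticForm ℂ V)) (d := Finsupp.lapply i)
    (d' := Finsupp.lapply j) x

lemma gr_induction {P : Gr → Prop} (h0 : ∀ r : ℂ, P (algebraMap ℂ Gr r))
    (h1 : ∀ x y, P x → P y → P (x + y))
    (h2 : ∀ (x : Gr) (v : V), P x → P (ExteriorAlgebra.ι ℂ v * x)) (x : Gr) : P x :=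
  CliffordAlgebra.left_induction (Q := (0 : QuadraticForm ℂ V)) h0 h1 h2 x

lemma gam_del (i : ℕ) (x : Gr) : gam (del i x) = -del i (gam x) := by
  induction x using gr_induction with
  | h0 r => simp [del_algebraMap, gam_algebraMap]
  | h1 x y hx hy => simp only [map_add, hx, hy]; abel
  | h2 x v hx =>
    simp only [del_ι_mul, gam_mul, gam_ι, map_sub, map_smul, hx, neg_mul, map_neg]
    noncomm_ring

/-- `∂_i` is an odd superderivation. -/
lemma del_mul (i : ℕ) (x y : Gr) : del i (x * y) = del i x * y + gam x * del i y := by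
  induction x using gr_induction with
  | h0 r =>
    simp only [del_algebraMap, gam_algebraMap, zero_mul, zero_add, ← Algebra.smul_def, map_smul]
  | h1 x z hx hz => simp only [add_mul, map_add, hx, hz]; abel
  | h2 x v hx =>
    simp only [mul_assoc, del_ι_mul, gam_mul, gam_ι, hx, sub_mul, smul_mul_assoc, mul_add, neg_mul]
    abel

lemma gam_of_mem {d : ℕ} {P : Gr} (hP : P ∈ ⋀[ℂ]^d V) : gam P = (-1 : ℂ) ^ d • P := by
  induction hP using Submodule.pow_induction_on_left' with
  | algebraMap r => simp [gam_algebraMap]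
  | add x y i hx hy h1 h2 => simp [h1, h2]
  | mem_mul m hm i x hx h =>
    obtain ⟨v, rfl⟩ := hm
    rw [gam_mul, gam_ι, h, pow_succ]
    simp

lemma ι_mul_eq (v : V) (x : Gr) :
    ExteriorAlgebra.ι ℂ v * x = gam x * ExteriorAlgebra.ι ℂ v := by
  induction x using gr_induction with
  | h0 r => rw [gam_algebraMap, Algebra.commutes]
  | h1 x y hx hy => simp only [mul_add, add_mul, map_add, hx, hy]
  | h2 x w hx =>
    have h := ExteriorAlgebra.ι_add_mul_swap (R := ℂ) v w
    rw [← mul_assoc, eq_neg_of_add_eq_zero_left h, gam_mul, gam_ι, neg_mul, mul_assoc, hx]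
    noncomm_ring

/-- `Λ(∞)` is supercommutative. -/
lemma mul_comm_of_mem {a b : ℕ} {P Q : Gr} (hP : P ∈ ⋀[ℂ]^a V) (hQ : Q ∈ ⋀[ℂ]^b V) :
    P * Q = (-1 : ℂ) ^ (a * b) • (Q * P) := by
  induction hP using Submodule.pow_induction_on_left' with
  | algebraMap r => simp [Algebra.commutes]
  | add x y i hx hy h1 h2 => simp [add_mul, mul_add, h1, h2]
  | mem_mul m hm i x hx h =>
    obtain ⟨v, rfl⟩ := hm
    rw [mul_assoc, h, mul_smul_comm, ← mul_assoc, ι_mul_eq, gam_of_mem hQ, smul_mul_assoc,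
      smul_mul_assoc, smul_smul, ← pow_add, mul_assoc]
    congr 2
    simp [Nat.succ_mul]

lemma del_mem {d : ℕ} {P : Gr} (hP : P ∈ ⋀[ℂ]^d V) (i : ℕ) :
    (d = 0 → del i P = 0) ∧ ∀ c, c + 1 = d → del i P ∈ ⋀[ℂ]^c V := by
  induction hP using Submodule.pow_induction_on_left' with
  | algebraMap r => simp [del_algebraMap]
  | add x y j hx hy h1 h2 =>
    refine ⟨fun h => by simp [h1.1 h, h2.1 h], fun c hc => ?_⟩
    rw [map_add]
    exact add_mem (h1.2 c hc) (h2.2 c hc)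
  | mem_mul m hm j x hx h =>
    obtain ⟨v, rfl⟩ := hm
    refine ⟨fun h => by simp at h, fun c hc => ?_⟩
    obtain rfl : c = j := by simpa using hc
    rw [del_ι_mul]
    refine sub_mem (Submodule.smul_mem _ _ hx) ?_
    rcases Nat.eq_zero_or_pos c with rfl | hpos
    · rw [h.1 rfl, mul_zero]; exact zero_mem _
    · obtain ⟨e, rfl⟩ : ∃ e, c = e + 1 := ⟨c - 1, by omega⟩
      have := h.2 e rfl
      show _ ∈ (LinearMap.range (ExteriorAlgebra.ι ℂ)) ^ (e + 1)
      rw [pow_succ']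
      exact Submodule.mul_mem_mul ⟨v, rfl⟩ this

/-! ### The Lie superalgebra `W(∞)` -/

/-- Conjugation by the grading involution: the parity operator of the superalgebra
`End Λ(∞)`, equal to `1` on even and to `-1` on odd operators. -/
def theta : Module.End ℂ Gr →ₗ[ℂ] Module.End ℂ Gr :=
  LinearMap.mulLeft ℂ gam ∘ₗ LinearMap.mulRight ℂ gam

lemma theta_apply (x : Module.End ℂ Gr) (P : Gr) : theta x P = gam (x (gam P)) := rfl

/-- The even component of an operator on `Λ(∞)`. -/
def evenPart (x : Module.End ℂ Gr) : Module.End ℂ Gr := (1 / 2 : ℂ) • (x + theta x)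

/-- The odd component of an operator on `Λ(∞)`. -/
def oddPart (x : Module.End ℂ Gr) : Module.End ℂ Gr := (1 / 2 : ℂ) • (x - theta x)

/-- The supercommutator on `End Λ(∞)`, that is, the bilinear extension of
`[x, y] = x y - (-1)^{|x||y|} y x` from homogeneous operators to all operators. -/
def sbr (x y : Module.End ℂ Gr) : Module.End ℂ Gr :=
  x * y - evenPart y * x - oddPart y * theta x

/-- On homogeneous operators the supercommutator is given by the usual formula. -/
lemma sbr_of_homogeneous {x y : Module.End ℂ Gr} {k l : ℤ}
    (hx : theta x = (-1 : ℂ) ^ k • x) (hy : theta y = (-1 : ℂ) ^ l • y) :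
    sbr x y = x * y - (-1 : ℂ) ^ (k * l) • (y * x) := by
  unfold sbr evenPart oddPart
  rw [hx, hy]
  rcases Int.even_or_odd k with hk | hk <;> rcases Int.even_or_odd l with hl | hl
  · rw [hk.neg_one_zpow, hl.neg_one_zpow, (hk.mul_right l).neg_one_zpow]
    simp only [one_smul, sub_mul, add_mul, smul_mul_assoc]
    module
  · rw [hk.neg_one_zpow, hl.neg_one_zpow, (hk.mul_right l).neg_one_zpow]
    simp only [one_smul, sub_mul, add_mul, smul_mul_assoc]
    module
  · rw [hk.neg_one_zpow, hl.neg_one_zpow, (hl.mul_left k).neg_one_zpow]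
    simp only [one_smul, sub_mul, add_mul, smul_mul_assoc]
    module
  · rw [hk.neg_one_zpow, hl.neg_one_zpow, (hk.mul hl).neg_one_zpow]
    simp only [sub_mul, add_mul, smul_mul_assoc, mul_smul_comm]
    module

lemma sbr_add_left (x x' y : Module.End ℂ Gr) : sbr (x + x') y = sbr x y + sbr x' y := by
  simp only [sbr, map_add, add_mul, mul_add]; abel

lemma sbr_smul_left (c : ℂ) (x y : Module.End ℂ Gr) : sbr (c • x) y = c • sbr x y := by
  simp only [sbr, map_smul, smul_mul_assoc, mul_smul_comm, smul_sub]

lemma sbr_add_right (x y y' : Module.End ℂ Gr) : sbr x (y + y') = sbr x y + sbr x y' := by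
  simp only [sbr, evenPart, oddPart, map_add, add_mul, mul_add, smul_add, sub_eq_add_neg, neg_add,
    smul_mul_assoc]
  abel

lemma sbr_smul_right (c : ℂ) (x y : Module.End ℂ Gr) : sbr x (c • y) = c • sbr x y := by
  simp only [sbr, evenPart, oddPart, map_smul, smul_mul_assoc, mul_smul_comm, add_mul, sub_mul]
  module

lemma sbr_zero_left (y : Module.End ℂ Gr) : sbr 0 y = 0 := by
  simpa using sbr_smul_left 0 0 y

lemma sbr_zero_right (x : Module.End ℂ Gr) : sbr x 0 = 0 := by
  simpa using sbr_smul_right 0 x 0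

/-- The homogeneous component `W(∞)^k = span {P ∂_j | P ∈ Λ(∞)^{k+1}}` (zero for `k < -1`),
as a space of operators on `Λ(∞)`. -/
def piece (k : ℤ) : Submodule ℂ (Module.End ℂ Gr) :=
  Submodule.span ℂ {x | ∃ d : ℕ, (d : ℤ) = k + 1 ∧ ∃ P ∈ ⋀[ℂ]^d V, ∃ j, x = fld P j}

/-- The Lie superalgebra `W(∞)`: the space of operators on `Λ(∞)` spanned by all `P ∂_j`. -/
def W : Submodule ℂ (Module.End ℂ Gr) :=
  Submodule.span ℂ {x | ∃ P j, x = fld P j}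

lemma fld_add (P Q : Gr) (i : ℕ) : fld (P + Q) i = fld P i + fld Q i := by
  refine LinearMap.ext fun x => ?_; simp [fld, add_mul]

lemma fld_smul (c : ℂ) (P : Gr) (i : ℕ) : fld (c • P) i = c • fld P i := by
  refine LinearMap.ext fun x => ?_; simp [fld]

lemma fld_zero (i : ℕ) : fld 0 i = 0 := by
  refine LinearMap.ext fun x => ?_; simp [fld]

lemma piece_le (k : ℤ) : piece k ≤ W :=
  Submodule.span_mono (by rintro x ⟨d, -, P, -, j, rfl⟩; exact ⟨P, j, rfl⟩)

lemma fld_mem_piece {d : ℕ} {P : Gr} (hP : P ∈ ⋀[ℂ]^d V) (j : ℕ) {k : ℤ} (h : (d : ℤ) = k + 1) :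
    fld P j ∈ piece k :=
  Submodule.subset_span ⟨d, h, P, hP, j, rfl⟩

lemma W_eq_iSup : W = ⨆ k, piece k := by
  refine le_antisymm ?_ (iSup_le piece_le)
  refine Submodule.span_le.2 ?_
  rintro x ⟨P, j, rfl⟩
  have hP : P ∈ ⨆ d : ℕ, ⋀[ℂ]^d V := by
    rw [(DirectSum.Decomposition.isInternal (fun d : ℕ => ⋀[ℂ]^d V)).submodule_iSup_eq_top]
    trivial
  induction hP using Submodule.iSup_induction' with
  | mem d P hP =>
    exact Submodule.mem_iSup_of_mem ((d : ℤ) - 1) (fld_mem_piece hP j (by ring))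
  | zero => rw [fld_zero]; exact zero_mem _
  | add P Q _ _ h1 h2 => rw [fld_add]; exact add_mem h1 h2

lemma theta_fld {d : ℕ} {P : Gr} (hP : P ∈ ⋀[ℂ]^d V) (j : ℕ) {k : ℤ} (h : (d : ℤ) = k + 1) :
    theta (fld P j) = (-1 : ℂ) ^ k • fld P j := by
  refine LinearMap.ext fun x => ?_
  rw [theta_apply, fld_apply, gam_mul, gam_del, gam_gam, gam_of_mem hP, LinearMap.smul_apply,
    fld_apply]
  have hk : k = (d : ℤ) - 1 := by omega
  rw [hk, zpow_sub₀ (by norm_num), zpow_natCast]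
  simp [div_eq_mul_inv]

lemma theta_piece {k : ℤ} {x : Module.End ℂ Gr} (hx : x ∈ piece k) :
    theta x = (-1 : ℂ) ^ k • x := by
  induction hx using Submodule.span_induction with
  | mem x hx => obtain ⟨d, hd, P, hP, j, rfl⟩ := hx; exact theta_fld hP j hd
  | zero => simp
  | add x y _ _ hx hy => rw [map_add, hx, hy, smul_add]
  | smul c x _ hx => rw [map_smul, hx, smul_comm]

lemma theta_mem_W {x : Module.End ℂ Gr} (hx : x ∈ W) : theta x ∈ W := by
  rw [W_eq_iSup] at hx
  induction hx using Submodule.iSup_induction' with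
  | mem k x hx => rw [theta_piece hx]; exact W.smul_mem _ (piece_le k hx)
  | zero => simp
  | add x y _ _ hx hy => rw [map_add]; exact add_mem hx hy

lemma fld_mul_fld (P Q : Gr) (i j : ℕ) (x : Gr) :
    fld P i (fld Q j x) = P * del i Q * del j x + P * gam Q * del i (del j x) := by
  simp only [fld_apply, del_mul, mul_add, mul_assoc]

/-- The bracket of `P ∂_i` and `Q ∂_j`. -/
lemma sbr_fld {a b : ℕ} {P Q : Gr} (hP : P ∈ ⋀[ℂ]^a V) (hQ : Q ∈ ⋀[ℂ]^b V) (i j : ℕ) :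
    sbr (fld P i) (fld Q j) =
      fld (P * del i Q) j - (-1 : ℂ) ^ ((a + 1) * (b + 1)) • fld (Q * del j P) i := by
  have h1 := theta_fld hP i (k := (a : ℤ) - 1) (by ring)
  have h2 := theta_fld hQ j (k := (b : ℤ) - 1) (by ring)
  have hs : (-1 : ℂ) ^ (((a : ℤ) - 1) * ((b : ℤ) - 1)) = (-1 : ℂ) ^ ((a + 1) * (b + 1)) := by
    have : (((a : ℤ) - 1) * ((b : ℤ) - 1)) = (((a + 1) * (b + 1) : ℕ) : ℤ) + 2 * (-a - b) := by
      push_cast; ring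
    rw [this, zpow_add₀ (by norm_num), zpow_mul, zpow_natCast]
    norm_num
  rw [sbr_of_homogeneous h1 h2, hs]
  refine LinearMap.ext fun x => ?_
  rw [LinearMap.sub_apply, LinearMap.sub_apply, LinearMap.smul_apply, LinearMap.smul_apply,
    Module.End.mul_apply, Module.End.mul_apply, fld_mul_fld, fld_mul_fld, gam_of_mem hP,
    gam_of_mem hQ, fld_apply, fld_apply, del_comm j i, mul_smul_comm, mul_smul_comm,
    mul_comm_of_mem hQ hP]
  have key : (-1 : ℂ) ^ b = - ((-1 : ℂ) ^ ((a + 1) * (b + 1)) * ((-1) ^ a * (-1) ^ (b * a))) := by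
    rw [← pow_add, ← pow_add]
    have : (a + 1) * (b + 1) + (a + b * a) = b + 1 + 2 * (a * b + a) := by ring
    rw [this, pow_add, pow_add, pow_mul]
    simp
  simp only [smul_mul_assoc, smul_add, smul_neg, mul_neg, smul_smul, key, neg_smul, neg_mul, mul_assoc]
  abel

lemma sbr_mem_piece {k l : ℤ} {x y : Module.End ℂ Gr} (hx : x ∈ piece k) (hy : y ∈ piece l) :
    sbr x y ∈ piece (k + l) := by
  have aux : ∀ {a b : ℕ} {P Q : Gr}, P ∈ ⋀[ℂ]^a V → Q ∈ ⋀[ℂ]^b V → ∀ (i j : ℕ) (m : ℤ),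
      (a : ℤ) + b = m + 2 → fld (P * del i Q) j ∈ piece m := by
    intro a b P Q hP hQ i j m hm
    rcases Nat.eq_zero_or_pos b with rfl | hpos
    · rw [(del_mem hQ i).1 rfl, mul_zero, fld_zero]; exact zero_mem _
    · obtain ⟨c, rfl⟩ : ∃ c, b = c + 1 := ⟨b - 1, by omega⟩
      have h := (del_mem hQ i).2 c rfl
      have hPQ : P * del i Q ∈ ⋀[ℂ]^(a + c) V := SetLike.mul_mem_graded hP h
      exact fld_mem_piece hPQ j (by push_cast at hm ⊢; omega)
  induction hx using Submodule.span_induction with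
  | mem x hx =>
    obtain ⟨a, ha, P, hP, i, rfl⟩ := hx
    induction hy using Submodule.span_induction with
    | mem y hy =>
      obtain ⟨b, hb, Q, hQ, j, rfl⟩ := hy
      rw [sbr_fld hP hQ]
      exact sub_mem (aux hP hQ i j _ (by omega))
        (Submodule.smul_mem _ _ (aux hQ hP j i _ (by omega)))
    | zero => rw [sbr_zero_right]; exact zero_mem _
    | add y z _ _ h1 h2 => rw [sbr_add_right]; exact add_mem h1 h2
    | smul c y _ h => rw [sbr_smul_right]; exact Submodule.smul_mem _ _ h
  | zero => rw [sbr_zero_left]; exact zero_mem _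
  | add y z _ _ h1 h2 => rw [sbr_add_left]; exact add_mem h1 h2
  | smul c y _ h => rw [sbr_smul_left]; exact Submodule.smul_mem _ _ h

lemma sbr_mem_W {x y : Module.End ℂ Gr} (hx : x ∈ W) (hy : y ∈ W) : sbr x y ∈ W := by
  rw [W_eq_iSup] at hx hy
  induction hx using Submodule.iSup_induction' with
  | mem k x hx =>
    induction hy using Submodule.iSup_induction' with
    | mem l y hy => exact piece_le _ (sbr_mem_piece hx hy)
    | zero => rw [sbr_zero_right]; exact zero_mem _
    | add y z _ _ h1 h2 => rw [sbr_add_right]; exact add_mem h1 h2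
  | zero => rw [sbr_zero_left]; exact zero_mem _
  | add y z _ _ h1 h2 => rw [sbr_add_left]; exact add_mem h1 h2

/-- The superbracket of `W(∞)`. -/
def br (x y : W) : W := ⟨sbr x y, sbr_mem_W x.2 y.2⟩

/-- The homogeneous component `𝔤^k` of `𝔤 = W(∞)`. An element of `𝔤^k` has parity `k mod 2`. -/
def gr (k : ℤ) : Submodule ℂ W := (piece k).comap W.subtype

/-- The parity operator `x ↦ (-1)^{|x|} x` of `𝔤`. -/
def parW : W →ₗ[ℂ] W := theta.restrict fun _ hx => theta_mem_W hx

lemma parW_of_mem {k : ℤ} {x : W} (hx : x ∈ gr k) : parW x = (-1 : ℂ) ^ k • x :=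
  Subtype.ext (theta_piece hx)

lemma br_mem {k l : ℤ} {x y : W} (hx : x ∈ gr k) (hy : y ∈ gr l) : br x y ∈ gr (k + l) :=
  sbr_mem_piece hx hy

lemma br_apply {k l : ℤ} {x y : W} (hx : x ∈ gr k) (hy : y ∈ gr l) :
    (br x y : Module.End ℂ Gr) =
      (x : Module.End ℂ Gr) * y - (-1 : ℂ) ^ (k * l) • ((y : Module.End ℂ Gr) * x) :=
  sbr_of_homogeneous (theta_piece hx) (theta_piece hy)

lemma parW_parW (x : W) : parW (parW x) = x := by
  refine Subtype.ext (LinearMap.ext fun P => ?_)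
  show theta (theta x) P = _
  simp [theta_apply, gam_gam]

lemma iSup_gr : ⨆ k, gr k = ⊤ := by
  refine eq_top_iff.2 fun x _ => ?_
  obtain ⟨x, hx⟩ := x
  have h : W ≤ (⨆ k, gr k).map W.subtype := by
    rw [Submodule.map_iSup]
    refine W_eq_iSup.le.trans (iSup_mono fun k y hy => ?_)
    exact ⟨⟨y, piece_le k hy⟩, hy, rfl⟩
  obtain ⟨y, hy, hyx⟩ := h hx
  rwa [show (⟨x, hx⟩ : W) = y from Subtype.ext hyx.symm]

/-- The subalgebra of `𝔤` generated by a set. -/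
def genBy (s : Set W) : Submodule ℂ W :=
  sInf {S | s ⊆ S ∧ ∀ x ∈ S, ∀ y ∈ S, br x y ∈ S}

/-- The element `P ∂_j` of `𝔤`. -/
def fldW (P : Gr) (j : ℕ) : W := ⟨fld P j, Submodule.subset_span ⟨P, j, rfl⟩⟩

/-- The subalgebra `𝔱_n` generated by all `ξ_{i_1} ⋯ ξ_{i_k} ∂_j` (`k ≥ 0`) with `j, i_t ≥ n`. -/
def tW (n : ℕ) : Submodule ℂ W :=
  genBy {x | ∃ (l : List ℕ) (j : ℕ), (∀ i ∈ l, n ≤ i) ∧ n ≤ j ∧ x = fldW (l.map xi).prod j}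

/-- The subalgebra `𝔤^≤ = 𝔤^{-1} ⊕ 𝔤^0`. -/
def gLE : Submodule ℂ W := gr (-1) ⊔ gr 0

/-! ### The Lie algebra `gl(∞)` -/

/-- The Lie algebra `gl(∞)`, realised as the degree zero component `𝔤^0` of `W(∞)`; it has the
basis `E_{i,j} = ξ_i ∂_j` of matrix units (see `E_lie`, `E_span` and `E_linearIndependent`). The
bracket is the commutator, which is the superbracket of `W(∞)` in degree zero. -/
def gl : LieSubalgebra ℂ (Module.End ℂ Gr) where
  __ := piece 0
  lie_mem' := by
    intro x y hx hy
    have h := sbr_mem_piece (k := 0) (l := 0) hx hy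
    rw [sbr_of_homogeneous (theta_piece hx) (theta_piece hy)] at h
    simpa [Ring.lie_def] using h

/-- The inclusion of `gl(∞) = 𝔤^0` into `𝔤`. -/
def toW : gl →ₗ[ℂ] W := Submodule.inclusion (piece_le 0)

lemma toW_mem (a : gl) : toW a ∈ gr 0 := a.2

lemma toW_lie (a b : gl) : toW ⁅a, b⁆ = br (toW a) (toW b) := by
  refine Subtype.ext ?_
  rw [br_apply (toW_mem a) (toW_mem b)]
  simp only [mul_zero, zpow_zero, one_smul]
  rfl

lemma xi_mem (i : ℕ) : xi i ∈ ⋀[ℂ]^1 V := by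
  show xi i ∈ LinearMap.range (ExteriorAlgebra.ι ℂ) ^ 1
  rw [pow_one]
  exact ⟨_, rfl⟩

/-- The matrix unit `E_{i,j} = ξ_i ∂_j` of `gl(∞)`. -/
def E (i j : ℕ) : gl := ⟨fld (xi i) j, fld_mem_piece (xi_mem i) j (by norm_num)⟩

lemma E_lie (i j k l : ℕ) :
    ⁅E i j, E k l⁆ = (if j = k then E i l else 0) - (if l = i then E k j else 0) := by
  refine Subtype.ext ?_
  have h1 : ((⁅E i j, E k l⁆ : gl) : Module.End ℂ Gr) = sbr (fld (xi i) j) (fld (xi k) l) := by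
    rw [sbr_of_homogeneous (x := fld (xi i) j) (y := fld (xi k) l) (theta_piece (E i j).2)
      (theta_piece (E k l).2)]
    simp only [mul_zero, zpow_zero, one_smul]
    rfl
  rw [h1, sbr_fld (xi_mem i) (xi_mem k), del_xi, del_xi]
  have h4 : (-1 : ℂ) ^ ((1 + 1) * (1 + 1)) = 1 := by norm_num
  rw [h4, one_smul]
  split_ifs <;> simp [fld_zero, E]

lemma E_span : Submodule.span ℂ (Set.range fun p : ℕ × ℕ => E p.1 p.2) = ⊤ := by
  refine eq_top_iff.2 fun x _ => ?_
  obtain ⟨x, hx⟩ := x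
  have h : piece 0 ≤ (Submodule.span ℂ (Set.range fun p : ℕ × ℕ => E p.1 p.2)).map
      gl.toSubmodule.subtype := by
    refine Submodule.span_le.2 ?_
    rintro y ⟨d, hd, P, hP, j, rfl⟩
    obtain rfl : d = 1 := by omega
    have hP' : P ∈ LinearMap.range (ExteriorAlgebra.ι (M := V) ℂ) := by
      have : P ∈ LinearMap.range (ExteriorAlgebra.ι (M := V) ℂ) ^ 1 := hP
      rwa [pow_one] at this
    obtain ⟨v, rfl⟩ := hP'
    induction v using Finsupp.induction_linear with
    | zero => rw [map_zero, fld_zero]; exact zero_mem _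
    | add v w h1 h2 =>
      have hm : ∀ v : V, ExteriorAlgebra.ι ℂ v ∈ ⋀[ℂ]^1 V := fun v => by
        show _ ∈ LinearMap.range (ExteriorAlgebra.ι ℂ) ^ 1
        rw [pow_one]
        exact ⟨_, rfl⟩
      rw [map_add, fld_add]
      exact add_mem (h1 (hm v)) (h2 (hm w))
    | single i c =>
      refine ⟨c • E i j, Submodule.smul_mem _ _ (Submodule.subset_span ⟨(i, j), rfl⟩), ?_⟩
      have : (Finsupp.single i c : V) = c • Finsupp.single i 1 := by simp
      rw [this]
      exact ((congrArg (fld · j) (map_smul (ExteriorAlgebra.ι ℂ) c (Finsupp.single i 1))).trans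
        (fld_smul c _ j)).symm
  obtain ⟨y, hy, hyx⟩ := h hx
  rwa [show (⟨x, hx⟩ : gl) = y from Subtype.ext hyx.symm]

lemma E_linearIndependent : LinearIndependent ℂ fun p : ℕ × ℕ => E p.1 p.2 := by
  rw [linearIndependent_iff]
  intro c hc
  ext ⟨i, j⟩
  have h := congrArg (fun a : gl => ExteriorAlgebra.ιInv ((a : Module.End ℂ Gr) (xi j)) i) hc
  have hE : ∀ p : ℕ × ℕ, ExteriorAlgebra.ιInv ((E p.1 p.2 : Module.End ℂ Gr) (xi j)) i
      = if p = (i, j) then (1 : ℂ) else 0 := by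
    rintro ⟨k, l⟩
    show ExteriorAlgebra.ιInv (xi k * del l (xi j)) i = _
    rw [del_xi]
    by_cases hl : l = j
    · subst hl
      have := ExteriorAlgebra.ι_leftInverse (R := ℂ) (Finsupp.single k (1 : ℂ))
      simp only [if_true, mul_one, xi, this]
      simp [Finsupp.single_apply]
    · simp [hl]
  let φ : gl →ₗ[ℂ] ℂ := Finsupp.lapply i ∘ₗ ExteriorAlgebra.ιInv ∘ₗ
    LinearMap.applyₗ (xi j) ∘ₗ gl.toSubmodule.subtype
  have h' : φ (Finsupp.linearCombination ℂ (fun p : ℕ × ℕ => E p.1 p.2) c) = 0 := by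
    rw [hc, map_zero]
  rw [Finsupp.apply_linearCombination] at h'
  have hφ : (φ ∘ fun p : ℕ × ℕ => E p.1 p.2) = fun p => if p = (i, j) then (1 : ℂ) else 0 :=
    funext hE
  rw [hφ, Finsupp.linearCombination_apply] at h'
  simpa [Finsupp.sum] using h'

/-- The subalgebra `𝔱'_n` of `gl(∞)` generated by the `E_{i,j}` with `i, j ≥ n`. -/
def tGl (n : ℕ) : LieSubalgebra ℂ gl :=
  LieSubalgebra.lieSpan ℂ gl {x | ∃ i j, n ≤ i ∧ n ≤ j ∧ x = E i j}

section GlModules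

variable (X : Type u) [AddCommGroup X] [Module ℂ X] [LieRingModule gl X] [LieModule ℂ gl X]

/-- A `gl(∞)`-module is integrable if every element of `gl(∞)` acts locally finitely. -/
def IsIntegrable : Prop :=
  ∀ (a : gl) (m : X), FiniteDimensional ℂ
    (Submodule.span ℂ (Set.range fun i : ℕ => ((LieModule.toEnd ℂ gl X a) ^ i) m))

/-- A `gl(∞)`-module has finite length if it has a finite composition series. -/
def HasFiniteLength : Prop :=
  ∃ s : RelSeries {p : LieSubmodule ℂ gl X × LieSubmodule ℂ gl X | p.1 ⋖ p.2},
    s.head = ⊥ ∧ s.last = ⊤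

/-- The large annihilator condition for `gl(∞)`-modules: the annihilator of every vector
contains some `𝔱'_n`. -/
def GlLAC : Prop := ∀ m : X, ∃ n, ∀ a ∈ tGl n, ⁅a, m⁆ = 0

/-- The objects of the category `𝕋_{gl(∞)}`. -/
structure MemTgl : Prop where
  finite_length : HasFiniteLength X
  integrable : IsIntegrable X
  lac : GlLAC X

end GlModules

/-- A `ℤ/2`-graded `gl(∞)`-module. As everywhere below, a `ℤ/2`-grading is encoded by its parity
operator `m ↦ (-1)^{|m|} m`, an involution whose eigenspaces for `1` and `-1` are the even and
the odd part. -/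
structure GlMod where
  carrier : Type u
  [addCommGroup : AddCommGroup carrier]
  [module : Module ℂ carrier]
  [lieRingModule : LieRingModule gl carrier]
  [lieModule : LieModule ℂ gl carrier]
  par : Module.End ℂ carrier
  par_par : ∀ m, par (par m) = m
  par_lie : ∀ (a : gl) (m : carrier), par ⁅a, m⁆ = ⁅a, par m⁆

attribute [instance] GlMod.addCommGroup GlMod.module GlMod.lieRingModule GlMod.lieModule

/-! ### Modules over `W(∞)` -/

/-- A `W(∞)`-module: a super vector space with an even linear map from `𝔤` to its endomorphisms
that takes the superbracket to the supercommutator. -/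
structure WMod where
  carrier : Type u
  [addCommGroup : AddCommGroup carrier]
  [module : Module ℂ carrier]
  par : Module.End ℂ carrier
  par_par : ∀ m, par (par m) = m
  act : W →ₗ[ℂ] Module.End ℂ carrier
  par_act : ∀ (k : ℤ), ∀ x ∈ gr k, ∀ m, par (act x m) = (-1 : ℂ) ^ k • act x (par m)
  act_br : ∀ (k l : ℤ), ∀ x ∈ gr k, ∀ y ∈ gr l, ∀ m,
    act (br x y) m = act x (act y m) - (-1 : ℂ) ^ (k * l) • act y (act x m)

attribute [instance] WMod.addCommGroup WMod.module

namespace WMod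

variable (M : WMod.{u})

/-- The even part of `M`. -/
def even : Submodule ℂ M.carrier := Module.End.eigenspace M.par 1

/-- The odd part of `M`. -/
def odd : Submodule ℂ M.carrier := Module.End.eigenspace M.par (-1)

/-- The two eigenspaces of the parity operator form a `ℤ/2`-grading. -/
lemma isCompl_even_odd : IsCompl M.even M.odd := by
  constructor
  · rw [Submodule.disjoint_def]
    intro m h0 h1
    have h0' := Module.End.mem_eigenspace_iff.1 h0
    have h1' := Module.End.mem_eigenspace_iff.1 h1
    rw [h0', one_smul, neg_smul, one_smul] at h1'
    have h2 : (2 : ℂ) • m = 0 := by rw [two_smul]; nth_rewrite 1 [h1']; simp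
    exact (smul_eq_zero.1 h2).resolve_left two_ne_zero
  · rw [codisjoint_iff, eq_top_iff]
    intro m _
    refine Submodule.mem_sup.2 ⟨(1 / 2 : ℂ) • (m + M.par m), ?_, (1 / 2 : ℂ) • (m - M.par m), ?_, ?_⟩
    · refine Module.End.mem_eigenspace_iff.2 ?_
      rw [map_smul, map_add, M.par_par, one_smul, add_comm]
    · refine Module.End.mem_eigenspace_iff.2 ?_
      rw [map_smul, map_sub, M.par_par]
      module
    · module

/-- A `ℤ`-grading of the `𝔤`-module `M` that is compatible with its superstructure. -/
structure IsZGrading (G : ℤ → Submodule ℂ M.carrier) : Prop where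
  internal : DirectSum.IsInternal G
  act_mem : ∀ i j : ℤ, ∀ x ∈ gr i, ∀ m ∈ G j, M.act x m ∈ G (i + j)
  even_eq : M.even = ⨆ k, G (2 * k)
  odd_eq : M.odd = ⨆ k, G (2 * k + 1)

/-- The large annihilator condition for a subalgebra `s` of `𝔤`. -/
def LAC (s : Submodule ℂ W) : Prop := ∀ m, ∃ n, ∀ x ∈ tW n ⊓ s, M.act x m = 0

/-- Restriction of a `𝔤`-module to `𝔤^0 = gl(∞)`. -/
instance : LieRingModule gl M.carrier where
  bracket a m := M.act (toW a) m
  add_lie a b m := by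
    show M.act (toW (a + b)) m = M.act (toW a) m + M.act (toW b) m
    simp
  lie_add a m n := map_add _ m n
  leibniz_lie a b m := by
    show M.act (toW a) (M.act (toW b) m) =
      M.act (toW ⁅a, b⁆) m + M.act (toW b) (M.act (toW a) m)
    rw [toW_lie, M.act_br 0 0 _ (toW_mem a) _ (toW_mem b)]
    simp

lemma lie_def (a : gl) (m : M.carrier) : ⁅a, m⁆ = M.act (toW a) m := rfl

instance : LieModule ℂ gl M.carrier where
  smul_lie c a m := by simp [lie_def]
  lie_smul c a m := by simp [lie_def]

/-- The objects of the category `𝕋_W^≤`. -/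
structure MemTWle : Prop where
  graded : ∃ G, M.IsZGrading G
  integrable : IsIntegrable M.carrier
  lac : M.LAC gLE

/-- The (`ℤ/2`-graded) submodules of a `𝔤`-module. -/
structure IsSubmod (S : Submodule ℂ M.carrier) : Prop where
  act_mem : ∀ x, ∀ m ∈ S, M.act x m ∈ S
  par_mem : ∀ m ∈ S, M.par m ∈ S

/-- A `𝔤`-module is simple if it is nonzero and has no submodules but `0` and itself. -/
structure IsSimple : Prop where
  nontrivial : Nontrivial M.carrier
  eq_bot_or_top : ∀ S, M.IsSubmod S → S = ⊥ ∨ S = ⊤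

/-- The quotient of a `𝔤`-module by a submodule. -/
def quot (S : Submodule ℂ M.carrier) (hS : M.IsSubmod S) : WMod.{u} where
  carrier := M.carrier ⧸ S
  par := S.mapQ S M.par hS.par_mem
  par_par := by
    rintro ⟨m⟩
    exact congrArg (Submodule.Quotient.mk (p := S)) (M.par_par m)
  act :=
    { toFun := fun x => S.mapQ S (M.act x) (hS.act_mem x)
      map_add' := fun x y => by ext m; simp
      map_smul' := fun c x => by ext m; simp }
  par_act := by
    rintro k x hx ⟨m⟩
    exact congrArg (Submodule.Quotient.mk (p := S)) (M.par_act k x hx m)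
  act_br := by
    rintro k l x hx y hy ⟨m⟩
    exact congrArg (Submodule.Quotient.mk (p := S)) (M.act_br k l x hx y hy m)

/-- An isomorphism of `𝔤`-modules: an even `𝔤`-linear bijection. -/
structure Iso (M N : WMod.{u}) where
  toEquiv : M.carrier ≃ₗ[ℂ] N.carrier
  map_act : ∀ x m, toEquiv (M.act x m) = N.act x (toEquiv m)
  map_par : ∀ m, toEquiv (M.par m) = N.par (toEquiv m)

/-- The `gl(∞)`-submodule `M^{𝔤^<}` of vectors annihilated by `𝔤^< = 𝔤^{-1}`. -/
def inv : LieSubmodule ℂ gl M.carrier where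
  carrier := {m | ∀ x ∈ gr (-1), M.act x m = 0}
  add_mem' := fun {m n} hm hn x hx => by rw [map_add, hm x hx, hn x hx, add_zero]
  zero_mem' := fun x _ => map_zero _
  smul_mem' := fun c m hm x hx => by rw [map_smul, hm x hx, smul_zero]
  lie_mem := by
    intro a m hm x hx
    have h := M.act_br 0 (-1) (toW a) (toW_mem a) x hx m
    have h' : br (toW a) x ∈ gr (-1) := by simpa using br_mem (toW_mem a) hx
    rw [hm x hx, map_zero, hm _ h'] at h
    simpa [lie_def] using h.symm

lemma par_mem_inv (m : M.carrier) (hm : m ∈ M.inv) : M.par m ∈ M.inv := by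
  intro x hx
  have h := M.par_act (-1) x hx m
  rw [hm x hx, map_zero] at h
  simpa using h.symm

/-- `Ψ(M) = M^{𝔤^<}`, as a `gl(∞)`-module with the `ℤ/2`-grading inherited from `M`. -/
def Psi : GlMod.{u} where
  carrier := M.inv
  par := M.par.restrict (p := M.inv.toSubmodule) (q := M.inv.toSubmodule) M.par_mem_inv
  par_par m := Subtype.ext (M.par_par m)
  par_lie a m := Subtype.ext (by
    show M.par (M.act (toW a) m) = M.act (toW a) (M.par m)
    simpa using M.par_act 0 (toW a) (toW_mem a) m)

end WMod

/-! ### The enveloping superalgebra and induced modules -/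

/-- The defining relations `x y = (-1)^{|x||y|} y x + [x, y]` of the enveloping superalgebra. -/
inductive URel : TensorAlgebra ℂ W → TensorAlgebra ℂ W → Prop
  | mk (k l : ℤ) (x y : W) (hx : x ∈ gr k) (hy : y ∈ gr l) :
    URel (TensorAlgebra.ι ℂ x * TensorAlgebra.ι ℂ y)
      ((-1 : ℂ) ^ (k * l) • (TensorAlgebra.ι ℂ y * TensorAlgebra.ι ℂ x)
        + TensorAlgebra.ι ℂ (br x y))

/-- The universal enveloping superalgebra `U(𝔤)`. -/
def U : Type := RingQuot URel

instance : Ring U := inferInstanceAs (Ring (RingQuot URel))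

instance : Algebra ℂ U := inferInstanceAs (Algebra ℂ (RingQuot URel))

/-- The quotient map from the tensor algebra to `U(𝔤)`. -/
def mkU : TensorAlgebra ℂ W →ₐ[ℂ] U := RingQuot.mkAlgHom ℂ URel

/-- The canonical map from `𝔤` to `U(𝔤)`. -/
def toU : W →ₗ[ℂ] U := mkU.toLinearMap ∘ₗ TensorAlgebra.ι ℂ

lemma mkU_ι (x : W) : mkU (TensorAlgebra.ι ℂ x) = toU x := rfl

lemma toU_mul {k l : ℤ} {x y : W} (hx : x ∈ gr k) (hy : y ∈ gr l) :
    toU x * toU y = (-1 : ℂ) ^ (k * l) • (toU y * toU x) + toU (br x y) := by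
  have h : mkU _ = mkU _ := RingQuot.mkAlgHom_rel ℂ (URel.mk k l x y hx hy)
  rwa [map_mul, map_add, map_smul, map_mul, mkU_ι, mkU_ι, mkU_ι] at h

/-- The universal property of `U(𝔤)`: a linear map `f` from `𝔤` to an algebra that satisfies the
defining relations extends to an algebra homomorphism. -/
def liftU {A : Type*} [Ring A] [Algebra ℂ A] (f : W →ₗ[ℂ] A)
    (hf : ∀ (k l : ℤ), ∀ x ∈ gr k, ∀ y ∈ gr l,
      f x * f y = (-1 : ℂ) ^ (k * l) • (f y * f x) + f (br x y)) : U →ₐ[ℂ] A :=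
  RingQuot.liftAlgHom ℂ ⟨TensorAlgebra.lift ℂ f, by
    rintro _ _ ⟨k, l, x, y, hx, hy⟩
    simpa only [map_mul, map_add, map_smul, TensorAlgebra.lift_ι_apply] using hf k l x hx y hy⟩

lemma liftU_toU {A : Type*} [Ring A] [Algebra ℂ A] (f : W →ₗ[ℂ] A)
    (hf : ∀ (k l : ℤ), ∀ x ∈ gr k, ∀ y ∈ gr l,
      f x * f y = (-1 : ℂ) ^ (k * l) • (f y * f x) + f (br x y)) (x : W) :
    liftU f hf (toU x) = f x := by
  refine (RingQuot.liftAlgHom_mkAlgHom_apply ℂ (TensorAlgebra.lift ℂ f) (s := URel) _ _).trans ?_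
  rw [TensorAlgebra.lift_ι_apply]

lemma U_hom_ext {A : Type*} [Ring A] [Algebra ℂ A] {f g : U →ₐ[ℂ] A}
    (h : ∀ x, f (toU x) = g (toU x)) : f = g :=
  RingQuot.ringQuot_ext' ℂ _ _ (TensorAlgebra.hom_ext (LinearMap.ext h))

/-- The parity automorphism of `U(𝔤)`, which extends that of `𝔤`. -/
def parU : U →ₐ[ℂ] U :=
  liftU (toU ∘ₗ parW) fun k l x hx y hy => by
    have hne : (-1 : ℂ) ≠ 0 := by norm_num
    simp only [map_smul, LinearMap.comp_apply,
      parW_of_mem hx, parW_of_mem hy, parW_of_mem (br_mem hx hy), smul_mul_assoc, mul_smul_comm,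
      toU_mul hx hy, zpow_add₀ hne]
    module

lemma parU_toU (x : W) : parU (toU x) = toU (parW x) := liftU_toU _ _ x

lemma parU_parU (u : U) : parU (parU u) = u := by
  have h : parU.comp parU = AlgHom.id ℂ U := by
    refine U_hom_ext fun x => ?_
    rw [AlgHom.comp_apply, parU_toU, parU_toU, parW_parW, AlgHom.id_apply]
  exact DFunLike.congr_fun h u

namespace GlMod

variable (X : GlMod.{u})

/-- The relations `u a ⊗ x = u ⊗ a x` (`a ∈ 𝔤^0`) and `u b ⊗ x = 0` (`b ∈ 𝔤^{-1}`) that present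
`U(𝔤) ⊗_{U(𝔤^≤)} X` as a quotient of `U(𝔤) ⊗ X`, where `𝔤^{-1}` acts on `X` by zero. -/
def indRel : Submodule ℂ (U ⊗[ℂ] X.carrier) :=
  Submodule.span ℂ
    ({z | ∃ (u : U) (a : gl) (x : X.carrier), z = (u * toU (toW a)) ⊗ₜ[ℂ] x - u ⊗ₜ[ℂ] ⁅a, x⁆} ∪
     {z | ∃ (u : U) (b : W) (x : X.carrier), b ∈ gr (-1) ∧ z = (u * toU b) ⊗ₜ[ℂ] x})

/-- Left multiplication by `w` on `U(𝔤) ⊗ X`. -/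
def leftMul : U →ₗ[ℂ] Module.End ℂ (U ⊗[ℂ] X.carrier) where
  toFun w := LinearMap.rTensor X.carrier (LinearMap.mulLeft ℂ w)
  map_add' v w := by ext; simp [add_mul, TensorProduct.add_tmul]
  map_smul' c w := by ext; simp [TensorProduct.smul_tmul']

/-- The parity operator on `U(𝔤) ⊗ X`. -/
def parInd : Module.End ℂ (U ⊗[ℂ] X.carrier) := TensorProduct.map parU.toLinearMap X.par

@[simp] lemma leftMul_tmul (w u : U) (x : X.carrier) :
    X.leftMul w (u ⊗ₜ x) = (w * u) ⊗ₜ x := rfl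

@[simp] lemma parInd_tmul (u : U) (x : X.carrier) :
    X.parInd (u ⊗ₜ x) = parU u ⊗ₜ X.par x := rfl

lemma leftMul_mem (w : U) : ∀ z ∈ X.indRel, X.leftMul w z ∈ X.indRel := by
  intro z hz
  refine (Submodule.span_le (p := X.indRel.comap (X.leftMul w))).2 ?_ hz
  rintro z (⟨u, a, x, rfl⟩ | ⟨u, b, x, hb, rfl⟩)
  · exact Submodule.subset_span (Or.inl ⟨w * u, a, x, by simp [mul_assoc]⟩)
  · exact Submodule.subset_span (Or.inr ⟨w * u, b, x, hb, by simp [mul_assoc]⟩)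

lemma parInd_mem : ∀ z ∈ X.indRel, X.parInd z ∈ X.indRel := by
  intro z hz
  refine (Submodule.span_le (p := X.indRel.comap X.parInd)).2 ?_ hz
  rintro z (⟨u, a, x, rfl⟩ | ⟨u, b, x, hb, rfl⟩)
  · refine Submodule.subset_span (Or.inl ⟨parU u, a, X.par x, ?_⟩)
    simp [parU_toU, parW_of_mem (toW_mem a), X.par_lie]
  · refine Submodule.subset_span (Or.inr ⟨parU u, -b, X.par x, neg_mem hb, ?_⟩)
    rw [parInd_tmul, map_mul, parU_toU, parW_of_mem hb, map_neg, map_smul]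
    congr 2
    rw [zpow_neg_one, inv_neg, inv_one]
    module

/-- The action of `U(𝔤)` on `U(𝔤) ⊗_{U(𝔤^≤)} X`. -/
def actInd : U →ₗ[ℂ] Module.End ℂ ((U ⊗[ℂ] X.carrier) ⧸ X.indRel) where
  toFun w := X.indRel.mapQ X.indRel (X.leftMul w) (X.leftMul_mem w)
  map_add' v w := by
    refine Submodule.linearMap_qext _ (LinearMap.ext fun z => ?_)
    simp only [LinearMap.comp_apply, Submodule.mkQ_apply, Submodule.mapQ_apply, map_add,
      LinearMap.add_apply, Submodule.Quotient.mk_add]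
  map_smul' c w := by
    refine Submodule.linearMap_qext _ (LinearMap.ext fun z => ?_)
    simp only [LinearMap.comp_apply, Submodule.mkQ_apply, Submodule.mapQ_apply, map_smul,
      LinearMap.smul_apply, Submodule.Quotient.mk_smul, RingHom.id_apply]

lemma parInd_parInd (z : U ⊗[ℂ] X.carrier) : X.parInd (X.parInd z) = z := by
  induction z with
  | zero => simp
  | add y z hy hz => simp only [map_add, hy, hz]
  | tmul u x => simp only [parInd_tmul, parU_parU, X.par_par]

lemma parInd_leftMul {k : ℤ} {x : W} (hx : x ∈ gr k) (z : U ⊗[ℂ] X.carrier) :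
    X.parInd (X.leftMul (toU x) z) = (-1 : ℂ) ^ k • X.leftMul (toU x) (X.parInd z) := by
  induction z with
  | zero => simp only [map_zero, smul_zero]
  | add y z hy hz => simp only [map_add, hy, hz, smul_add]
  | tmul u m =>
    rw [leftMul_tmul, parInd_tmul, parInd_tmul, leftMul_tmul, map_mul, parU_toU, parW_of_mem hx,
      map_smul, smul_mul_assoc, TensorProduct.smul_tmul']

lemma leftMul_mul (v w : U) (z : U ⊗[ℂ] X.carrier) :
    X.leftMul (v * w) z = X.leftMul v (X.leftMul w z) := by
  induction z with
  | zero => simp only [map_zero]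
  | add y z hy hz => simp only [map_add, hy, hz]
  | tmul u m => rw [leftMul_tmul, leftMul_tmul, leftMul_tmul, mul_assoc]

lemma leftMul_br {k l : ℤ} {x y : W} (hx : x ∈ gr k) (hy : y ∈ gr l) (z : U ⊗[ℂ] X.carrier) :
    X.leftMul (toU (br x y)) z = X.leftMul (toU x) (X.leftMul (toU y) z) -
      (-1 : ℂ) ^ (k * l) • X.leftMul (toU y) (X.leftMul (toU x) z) := by
  have h := congrArg (fun w => X.leftMul w z) (toU_mul hx hy)
  simp only [map_add, map_smul, LinearMap.add_apply, LinearMap.smul_apply, leftMul_mul] at h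
  rw [h, add_sub_cancel_left]

/-- The induced module `K^-(X) = U(𝔤) ⊗_{U(𝔤^≤)} X`, where `𝔤^{-1}` acts on `X` by zero. -/
def KMinus : WMod.{u} where
  carrier := (U ⊗[ℂ] X.carrier) ⧸ X.indRel
  par := X.indRel.mapQ X.indRel X.parInd X.parInd_mem
  par_par := fun m => by
    induction m using Submodule.Quotient.induction_on with
    | H z => rw [Submodule.mapQ_apply, Submodule.mapQ_apply, parInd_parInd]
  act := X.actInd ∘ₗ toU
  par_act := fun k x hx m => by
    induction m using Submodule.Quotient.induction_on with
    | H z =>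
      exact congrArg (Submodule.Quotient.mk (p := X.indRel)) (X.parInd_leftMul hx z)
  act_br := fun k l x hx y hy m => by
    induction m using Submodule.Quotient.induction_on with
    | H z =>
      exact congrArg (Submodule.Quotient.mk (p := X.indRel)) (X.leftMul_br hx hy z)

/-- The sum of all proper submodules of `K^-(X)`; for a simple `gl(∞)`-module `X` this is the
unique maximal proper submodule. -/
def maxSub : Submodule ℂ X.KMinus.carrier := sSup {S | X.KMinus.IsSubmod S ∧ S ≠ ⊤}

lemma maxSub_isSubmod : X.KMinus.IsSubmod X.maxSub where
  act_mem x := by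
    have h : X.maxSub ≤ X.maxSub.comap (X.KMinus.act x) :=
      sSup_le fun S hS m hm => (le_sSup hS : S ≤ X.maxSub) (hS.1.act_mem x m hm)
    exact h
  par_mem := by
    have h : X.maxSub ≤ X.maxSub.comap X.KMinus.par :=
      sSup_le fun S hS m hm => (le_sSup hS : S ≤ X.maxSub) (hS.1.par_mem m hm)
    exact h

/-- `L^-(X)`, the unique simple quotient of `K^-(X)` for a simple `gl(∞)`-module `X`. -/
def LMinus : WMod.{u} := X.KMinus.quot X.maxSub X.maxSub_isSubmod

end GlMod

end WInf

end

noncomputable section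

namespace WInf

/-! ### The structure of `W(∞)` in low degree -/

/-! (a) Take a nonzero homogeneous vector. The annihilator condition makes all but finitely many
`∂_i` kill it. Since the `∂_i` anticommute and square to zero, applying those of the remaining ones
that do not give zero ends at a nonzero homogeneous vector killed by all of `𝔤^{-1}`
(`exists_homogeneous_mem_inv`).

(b) Let `M` be simple, and let `v` be a nonzero homogeneous invariant of degree `k`. A graded
`𝔤^0`-stable space `N` of invariants generates its closure under the positive components
(`posClosure_isSubmod`), so if `N` lies in degree `k`, the generated submodule is `N` plus terms of
degree above `k`. Invariants of degree above `k` would generate a submodule missing `v`, so there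
are none. Hence a nonzero `𝔤^0`-stable `N` inside the degree `k` invariants, which generates `M`,
already contains every invariant. Thus `Ψ(M)` is simple and lies in one degree
(`IsSimple.exists_degree`), and it inherits integrability and the annihilator condition from `M`.

For the isomorphism, the canonical map `K^-(Ψ(M)) → M` is onto, and its kernel has to contain every
proper submodule `S`. Otherwise `S` maps onto `M`, and some `x + t` in `S` maps to a nonzero `v` in
`Ψ(M)`, with `x` in `Ψ(M)` and `t` of positive relative degree; comparing degrees in `M` gives `x =
v`. If `x` itself lies in `S`, then `S` contains the generating copy of `Ψ(M)` by simplicity, so `S`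
is everything.

The obstacle is that `S` is only `ℤ/2`-graded, so `x` cannot simply be projected out. The Euler
field `∑ ξ_i ∂_i` would separate degrees, but the infinite sum is not in `W(∞)`. Its truncations
serve instead: on a fixed element of `𝔤^k` they eventually act by the scalar `k`. Integrability, the
annihilator condition and simplicity make them eventually act on each vector of `Ψ(M)` by one common
scalar `c` (`IsSimple.inv_le_eulerSpace`). They then separate `x` from `t` inside `S`
(`IsSubmod.mem_of_add_mem`). -/

lemma gr_eq_bot {k : ℤ} (hk : k < -1) : gr k = ⊥ := by
  have h : piece k = ⊥ := by
    refine Submodule.span_eq_bot.2 ?_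
    rintro x ⟨d, hd, -⟩
    omega
  rw [gr, h]
  exact (Submodule.eq_bot_iff _).2 fun x hx => Subtype.ext hx

lemma fldW_mem_gr {d : ℕ} {P : Gr} (hP : P ∈ ⋀[ℂ]^d V) (j : ℕ) {k : ℤ} (h : (d : ℤ) = k + 1) :
    fldW P j ∈ gr k :=
  fld_mem_piece hP j h

/-- Each `𝔤^k` is spanned by the `P ∂_j` with `P` homogeneous of degree `k + 1`. -/
lemma gr_span_induction {k : ℤ} {p : W → Prop}
    (fld : ∀ d : ℕ, (d : ℤ) = k + 1 → ∀ P ∈ ⋀[ℂ]^d V, ∀ j, p (fldW P j))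
    (zero : p 0) (add : ∀ x y, p x → p y → p (x + y)) (smul : ∀ (c : ℂ) x, p x → p (c • x))
    {x : W} (hx : x ∈ gr k) : p x := by
  obtain ⟨x, hxW⟩ := x
  have hx' : x ∈ piece k := hx
  -- The span is taken among operators while `p` lives on `W`, so membership in `W` is carried along
  -- in the induction.
  have : ∃ h : x ∈ W, p ⟨x, h⟩ := by
    clear hx hxW
    induction hx' using Submodule.span_induction with
    | mem x hx => obtain ⟨d, hd, P, hP, j, rfl⟩ := hx; exact ⟨_, fld d hd P hP j⟩
    | zero => exact ⟨W.zero_mem, zero⟩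
    | add x y _ _ h1 h2 =>
      obtain ⟨h1, h1'⟩ := h1
      obtain ⟨h2, h2'⟩ := h2
      exact ⟨W.add_mem h1 h2, add _ _ h1' h2'⟩
    | smul c x _ h =>
      obtain ⟨h, h'⟩ := h
      exact ⟨W.smul_mem c h, smul _ _ h'⟩
  exact this.2

/-- The element `∂_j` of `𝔤^{-1}`. -/
def delW (j : ℕ) : W := fldW 1 j

lemma one_mem_exteriorPower_zero : (1 : Gr) ∈ ⋀[ℂ]^0 V := by
  simp

lemma delW_mem (j : ℕ) : delW j ∈ gr (-1) :=
  fldW_mem_gr one_mem_exteriorPower_zero j (by norm_num)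

lemma br_delW (i j : ℕ) : br (delW i) (delW j) = 0 := by
  refine Subtype.ext ((sbr_fld one_mem_exteriorPower_zero one_mem_exteriorPower_zero i j).trans ?_)
  have h : ∀ i, del i (1 : Gr) = 0 := fun i => by simpa using del_algebraMap i 1
  simp [h, fld_zero]

lemma delW_mem_tW {n j : ℕ} (h : n ≤ j) : delW j ∈ tW n :=
  Submodule.mem_sInf.2 fun _ hS => hS.1 ⟨[], j, by simp, h, by simp [delW]⟩

lemma E_mem_tW {n i j : ℕ} (hi : n ≤ i) (hj : n ≤ j) : toW (E i j) ∈ tW n :=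
  Submodule.mem_sInf.2 fun _ hS => hS.1 ⟨[i], j, by simpa using hi, hj, by
    simp only [List.map_cons, List.map_nil, List.prod_cons, List.prod_nil, mul_one]
    rfl⟩

lemma br_mem_tW {n : ℕ} {x y : W} (hx : x ∈ tW n) (hy : y ∈ tW n) : br x y ∈ tW n :=
  Submodule.mem_sInf.2 fun S hS =>
    hS.2 x (Submodule.mem_sInf.1 hx S hS) y (Submodule.mem_sInf.1 hy S hS)

/-- In degree zero the superbracket is the commutator, so the preimage of `tW n` is a Lie subalgebra
containing the generators of `tGl n`. This transfers the annihilator condition from `𝔤` to `gl(∞)`.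
-/
lemma toW_mem_tW {n : ℕ} {a : gl} (ha : a ∈ tGl n) : toW a ∈ tW n := by
  let s : LieSubalgebra ℂ gl :=
    { (tW n).comap toW with
      lie_mem' := fun {a b} ha hb => by
        show toW ⁅a, b⁆ ∈ tW n
        rw [toW_lie]
        exact br_mem_tW ha hb }
  have h : tGl n ≤ s := LieSubalgebra.lieSpan_le.2 (by
    rintro x ⟨i, j, hi, hj, rfl⟩
    exact E_mem_tW hi hj)
  exact h ha

/-! ### The truncated Euler fields -/

/-- The truncated Euler field `∑_{i < N} ξ_i ∂_i`. -/
def euler (N : ℕ) : gl := ∑ i ∈ Finset.range N, E i i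

lemma euler_apply (N : ℕ) (x : Gr) :
    (euler N : Module.End ℂ Gr) x = ∑ i ∈ Finset.range N, xi i * del i x := by
  have h : (euler N : Module.End ℂ Gr) = ∑ i ∈ Finset.range N, (E i i : Module.End ℂ Gr) :=
    map_sum gl.toSubmodule.subtype _ _
  rw [h, LinearMap.sum_apply]
  rfl

lemma sum_smul_xi (v : V) {N : ℕ} (hN : v.support ⊆ Finset.range N) :
    ∑ i ∈ Finset.range N, v i • xi i = ExteriorAlgebra.ι ℂ v := by
  conv_rhs => rw [← Finsupp.sum_single v]
  rw [Finsupp.sum_of_support_subset v hN _ (by simp), map_sum]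
  refine Finset.sum_congr rfl fun i _ => ?_
  rw [xi, ← map_smul, Finsupp.smul_single_one]

/-- On `Λ^d(V)` the truncated Euler fields are eventually equal to `d`. -/
lemma euler_eventually {d : ℕ} {P : Gr} (hP : P ∈ ⋀[ℂ]^d V) :
    ∀ᶠ N in Filter.atTop, (euler N : Module.End ℂ Gr) P = (d : ℂ) • P := by
  induction hP using Submodule.pow_induction_on_left' with
  | algebraMap r => simp [euler_apply, del_algebraMap]
  | add x y i hx hy h1 h2 =>
    filter_upwards [h1, h2] with N h1 h2
    rw [map_add, h1, h2, smul_add]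
  | mem_mul m hm i x hx h =>
    obtain ⟨v, rfl⟩ := hm
    obtain ⟨n, hn⟩ := v.support.exists_nat_subset_range
    filter_upwards [h, Filter.eventually_ge_atTop n] with N h hN
    have hv := sum_smul_xi v (hn.trans (Finset.range_mono hN))
    rw [euler_apply] at h ⊢
    -- The sign from moving `ξ_j` past `v` cancels the one in `∂_j (v x)`, so the truncated Euler
    -- field is an even derivation that fixes `v` once `N` exceeds the support of `v`.
    have hsw : ∀ j, xi j * ExteriorAlgebra.ι ℂ v = -(ExteriorAlgebra.ι ℂ v * xi j) := fun j =>
      eq_neg_of_add_eq_zero_left (ExteriorAlgebra.ι_add_mul_swap (R := ℂ) _ v)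
    calc ∑ j ∈ Finset.range N, xi j * del j (ExteriorAlgebra.ι ℂ v * x)
        = (∑ j ∈ Finset.range N, v j • xi j) * x
          + ExteriorAlgebra.ι ℂ v * ∑ j ∈ Finset.range N, xi j * del j x := by
          rw [Finset.sum_mul, Finset.mul_sum, ← Finset.sum_add_distrib]
          refine Finset.sum_congr rfl fun j _ => ?_
          rw [del_ι_mul, mul_sub, ← mul_assoc, hsw, ← mul_assoc, mul_smul_comm, smul_mul_assoc,
            neg_mul, sub_neg_eq_add]
      _ = _ := by
          rw [hv, h, mul_smul_comm]
          push_cast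
          module

lemma br_add_left (x y z : W) : br (x + y) z = br x z + br y z :=
  Subtype.ext (sbr_add_left _ _ _)

lemma br_sum_left {ι : Type*} (s : Finset ι) (f : ι → W) (y : W) :
    br (∑ i ∈ s, f i) y = ∑ i ∈ s, br (f i) y := by
  classical
  induction s using Finset.induction_on with
  | empty => exact Subtype.ext (sbr_zero_left _)
  | insert a s ha ih => rw [Finset.sum_insert ha, Finset.sum_insert ha, br_add_left, ih]

/-- The truncated Euler fields eventually act on an element of `𝔤^k` as the scalar `k`. -/
lemma br_euler_eventually {k : ℤ} {x : W} (hx : x ∈ gr k) :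
    ∀ᶠ N in Filter.atTop, br (toW (euler N)) x = (k : ℂ) • x := by
  refine gr_span_induction (p := fun x => ∀ᶠ N in Filter.atTop, br (toW (euler N)) x = (k : ℂ) • x)
    ?_ ?_ ?_ ?_ hx
  · intro d hd P hP j
    filter_upwards [euler_eventually hP, Filter.eventually_gt_atTop j] with N hN hj
    -- The subtracted term comes from bracketing with `∂_j`. It occurs exactly once in the sum as `N
    -- > j`, and lowers the degree `d` of `P` to `k = d - 1`.
    have h1 : ∀ i, br (toW (E i i)) (fldW P j)
        = fldW (xi i * del i P) j - if i = j then fldW P j else 0 := by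
      intro i
      refine Subtype.ext ((sbr_fld (xi_mem i) hP i j).trans ?_)
      have h4 : (-1 : ℂ) ^ ((1 + 1) * (d + 1)) = 1 := by rw [pow_mul]; norm_num
      rw [h4, one_smul, del_xi]
      by_cases hij : i = j
      · subst hij; simp [fldW]
      · simp [hij, Ne.symm hij, fldW, fld_zero]
    have h2 : ∑ i ∈ Finset.range N, fldW (xi i * del i P) j = (d : ℂ) • fldW P j := by
      rw [euler_apply] at hN
      let f : Gr →ₗ[ℂ] W :=
        { toFun := fun Q => fldW Q j
          map_add' := fun Q R => Subtype.ext (fld_add Q R j)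
          map_smul' := fun c Q => Subtype.ext (fld_smul c Q j) }
      have := congrArg f hN
      rwa [map_sum, map_smul] at this
    rw [euler, map_sum, br_sum_left, Finset.sum_congr rfl fun i _ => h1 i,
      Finset.sum_sub_distrib, h2, Finset.sum_ite_eq', if_pos (Finset.mem_range.2 hj)]
    have : (k : ℂ) = (d : ℂ) - 1 := by
      have : k = (d : ℤ) - 1 := by omega
      rw [this]; push_cast; ring
    rw [this]
    module
  · filter_upwards with N
    rw [smul_zero]
    exact Subtype.ext (sbr_zero_right _)
  · intro x y hx hy
    filter_upwards [hx, hy] with N hx hy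
    rw [smul_add, ← hx, ← hy]
    exact Subtype.ext (sbr_add_right _ _ _)
  · intro c x hx
    filter_upwards [hx] with N hx
    rw [smul_comm, ← hx]
    exact Subtype.ext (sbr_smul_right _ _ _)

end WInf

namespace WInf

namespace WMod

variable (M : WMod.{u})

/-! ### Vectors annihilated by `𝔤^{-1}` -/

lemma act_delW_anticomm (i j : ℕ) (m : M.carrier) :
    M.act (delW i) (M.act (delW j) m) = -M.act (delW j) (M.act (delW i) m) := by
  have h := M.act_br (-1) (-1) _ (delW_mem i) _ (delW_mem j) m
  rw [br_delW, map_zero, LinearMap.zero_apply] at h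
  norm_num at h
  exact eq_neg_of_add_eq_zero_left h.symm

/-- `Λ^0(V)` consists of scalars, so the `∂_i` span `𝔤^{-1}`. -/
lemma mem_inv_of_delW {m : M.carrier} (h : ∀ i, M.act (delW i) m = 0) : m ∈ M.inv := by
  intro x hx
  refine gr_span_induction (p := fun x => M.act x m = 0) ?_ ?_ ?_ ?_ hx
  · intro d hd P hP j
    obtain rfl : d = 0 := by omega
    obtain ⟨c, rfl⟩ : ∃ c : ℂ, c • (1 : Gr) = P := by
      have : P ∈ (1 : Submodule ℂ Gr) := by simpa using hP
      obtain ⟨c, hc⟩ := Submodule.mem_one.1 this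
      exact ⟨c, by rw [← hc, Algebra.algebraMap_eq_smul_one]⟩
    have : fldW (c • 1) j = c • delW j := Subtype.ext (fld_smul c 1 j)
    rw [this, map_smul, LinearMap.smul_apply, h, smul_zero]
  · simp
  · intro x y hx hy
    rw [map_add, LinearMap.add_apply, hx, hy, add_zero]
  · intro c x hx
    rw [map_smul, LinearMap.smul_apply, hx, smul_zero]

variable {M}

/-- Induction on the number of `∂_i` that may fail to kill `m`. If `∂_n m ≠ 0`, replace `m` by `∂_n
m`: it is killed by `∂_n` because `∂_n² = 0`, and by each later `∂_i` because that anticommutes with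
`∂_n`. -/
lemma exists_mem_inv_of_delW {G : ℤ → Submodule ℂ M.carrier} (hG : M.IsZGrading G) (n : ℕ) :
    ∀ (j : ℤ) (m : M.carrier), m ∈ G j → m ≠ 0 → (∀ i, n ≤ i → M.act (delW i) m = 0) →
      ∃ k, ∃ v ∈ G k, v ≠ 0 ∧ v ∈ M.inv := by
  induction n with
  | zero => exact fun j m hm h0 h => ⟨j, m, hm, h0, M.mem_inv_of_delW fun i => h i i.zero_le⟩
  | succ n ih =>
    intro j m hm h0 h
    by_cases hn : M.act (delW n) m = 0
    · refine ih j m hm h0 fun i hi => ?_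
      rcases hi.eq_or_lt with rfl | hi
      · exact hn
      · exact h i hi
    · refine ih (-1 + j) _ (hG.act_mem (-1) j _ (delW_mem n) m hm) hn fun i hi => ?_
      rcases hi.eq_or_lt with rfl | hi
      · have h2 : (2 : ℂ) • M.act (delW n) (M.act (delW n) m) = 0 := by
          rw [two_smul, ← sub_neg_eq_add, ← M.act_delW_anticomm n n m, sub_self]
        exact (smul_eq_zero.1 h2).resolve_left two_ne_zero
      · rw [M.act_delW_anticomm, h i hi, map_zero, neg_zero]

/-- A nonzero module in `𝕋_W^≤` has a nonzero homogeneous vector annihilated by `𝔤^{-1}`. -/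
lemma exists_homogeneous_mem_inv {G : ℤ → Submodule ℂ M.carrier} (hG : M.IsZGrading G)
    (hM : M.LAC gLE) [Nontrivial M.carrier] : ∃ k, ∃ v ∈ G k, v ≠ 0 ∧ v ∈ M.inv := by
  obtain ⟨j, hj⟩ : ∃ j, G j ≠ ⊥ := by
    by_contra! h
    have := hG.internal.submodule_iSup_eq_top
    rw [show G = fun _ => ⊥ from funext h, iSup_bot] at this
    exact bot_ne_top this
  obtain ⟨m, hm, h0⟩ := (Submodule.ne_bot_iff _).1 hj
  obtain ⟨n, hn⟩ := hM m
  exact exists_mem_inv_of_delW hG n j m hm h0 fun i hi =>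
    hn _ ⟨delW_mem_tW hi, (le_sup_left : gr (-1) ≤ gLE) (delW_mem i)⟩

/-! ### The submodule generated by a subspace of `Ψ(M)` -/

/-- The closure of a subspace under the action of `𝔤^i` for `i ≥ 1`. -/
def posClosure (N : Submodule ℂ M.carrier) : Submodule ℂ M.carrier :=
  sInf {T | N ≤ T ∧ ∀ i : ℤ, 1 ≤ i → ∀ x ∈ gr i, ∀ m ∈ T, M.act x m ∈ T}

lemma le_posClosure (N : Submodule ℂ M.carrier) : N ≤ posClosure N :=
  le_sInf fun _ hT => hT.1

lemma posClosure_le {N T : Submodule ℂ M.carrier} (h : N ≤ T)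
    (hT : ∀ i : ℤ, 1 ≤ i → ∀ x ∈ gr i, ∀ m ∈ T, M.act x m ∈ T) : posClosure N ≤ T :=
  sInf_le ⟨h, hT⟩

lemma act_mem_posClosure {N : Submodule ℂ M.carrier} {i : ℤ} (hi : 1 ≤ i) {x : W} (hx : x ∈ gr i)
    {m : M.carrier} (hm : m ∈ posClosure N) : M.act x m ∈ posClosure N :=
  Submodule.mem_sInf.2 fun T hT => hT.2 i hi x hx m (Submodule.mem_sInf.1 hm T hT)

lemma act_act {k l : ℤ} {x y : W} (hx : x ∈ gr k) (hy : y ∈ gr l) (m : M.carrier) :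
    M.act x (M.act y m) = M.act (br x y) m + (-1 : ℂ) ^ (k * l) • M.act y (M.act x m) := by
  rw [M.act_br k l x hx y hy, sub_add_cancel]

/-- The vectors of the closure that `𝔤^0` keeps inside it contain `N` and are stable under each
`𝔤^i` with `i ≥ 1`, because `[𝔤^0, 𝔤^i] ⊆ 𝔤^i`. By minimality they are the whole closure. -/
lemma posClosure_act_zero {N : Submodule ℂ M.carrier}
    (h0 : ∀ x ∈ gr 0, ∀ m ∈ N, M.act x m ∈ N) :
    ∀ x ∈ gr 0, ∀ m ∈ posClosure N, M.act x m ∈ posClosure N := by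
  let T : Submodule ℂ M.carrier := posClosure N ⊓ ⨅ x : gr 0, (posClosure N).comap (M.act x)
  have h : posClosure N ≤ T := by
    refine posClosure_le (le_inf (le_posClosure N) (le_iInf fun x m hm =>
      le_posClosure N (h0 x x.2 m hm))) fun i hi y hy m hm => ?_
    have hm2 := (Submodule.mem_iInf _).1 hm.2
    refine ⟨act_mem_posClosure hi hy hm.1, (Submodule.mem_iInf _).2 fun x => ?_⟩
    rw [Submodule.mem_comap, act_act x.2 hy]
    refine add_mem (act_mem_posClosure hi ?_ hm.1)
      (Submodule.smul_mem _ _ (act_mem_posClosure hi hy (hm2 x)))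
    simpa using br_mem x.2 hy
  exact fun x hx m hm => (Submodule.mem_iInf _).1 (h hm).2 ⟨x, hx⟩

/-- Same minimality argument, now with `[𝔤^{-1}, 𝔤^i] ⊆ 𝔤^{i-1}`. For `i = 1` the bracket falls into
`𝔤^0`, where stability is already known. -/
lemma posClosure_act_neg {N : Submodule ℂ M.carrier} (hN : N ≤ M.inv.toSubmodule)
    (h0 : ∀ x ∈ gr 0, ∀ m ∈ N, M.act x m ∈ N) :
    ∀ x ∈ gr (-1), ∀ m ∈ posClosure N, M.act x m ∈ posClosure N := by
  let T : Submodule ℂ M.carrier := posClosure N ⊓ ⨅ x : gr (-1), (posClosure N).comap (M.act x)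
  have h : posClosure N ≤ T := by
    refine posClosure_le (le_inf (le_posClosure N) (le_iInf fun x m hm => ?_))
      fun i hi y hy m hm => ?_
    · rw [Submodule.mem_comap, hN hm x x.2]
      exact zero_mem _
    have hm2 := (Submodule.mem_iInf _).1 hm.2
    refine ⟨act_mem_posClosure hi hy hm.1, (Submodule.mem_iInf _).2 fun x => ?_⟩
    rw [Submodule.mem_comap, act_act x.2 hy]
    refine add_mem ?_ (Submodule.smul_mem _ _ (act_mem_posClosure hi hy (hm2 x)))
    have hb := br_mem x.2 hy
    rcases hi.eq_or_lt with rfl | hi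
    · exact posClosure_act_zero h0 _ (by simpa using hb) m hm.1
    · exact act_mem_posClosure (by omega) hb hm.1
  exact fun x hx m hm => (Submodule.mem_iInf _).1 (h hm).2 ⟨x, hx⟩

/-- This plays the role of `U(𝔤) N = U(𝔤^{>0}) N` and avoids a PBW theorem: reordering by brackets
suffices, as nothing lives below degree `-1`. -/
lemma posClosure_isSubmod {N : Submodule ℂ M.carrier} (hN : N ≤ M.inv.toSubmodule)
    (h0 : ∀ x ∈ gr 0, ∀ m ∈ N, M.act x m ∈ N) (hp : ∀ m ∈ N, M.par m ∈ N) :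
    M.IsSubmod (posClosure N) where
  act_mem x m hm := by
    have hx : x ∈ ⨆ k, gr k := by rw [iSup_gr]; trivial
    induction hx using Submodule.iSup_induction' with
    | mem k x hx =>
      rcases lt_trichotomy k 0 with hk | rfl | hk
      · rcases (show k ≤ -1 by omega).eq_or_lt with rfl | hk
        · exact posClosure_act_neg hN h0 x hx m hm
        · rw [gr_eq_bot hk] at hx
          rw [(Submodule.mem_bot ℂ).1 hx, map_zero]
          exact zero_mem _
      · exact posClosure_act_zero h0 x hx m hm
      · exact act_mem_posClosure (by omega) hx hm
    | zero => rw [map_zero]; exact zero_mem _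
    | add x y _ _ hx hy => rw [map_add]; exact add_mem hx hy
  par_mem := by
    have h : posClosure N ≤ posClosure N ⊓ (posClosure N).comap M.par := by
      refine posClosure_le (le_inf (le_posClosure N) fun m hm => le_posClosure N (hp m hm))
        fun i hi y hy m hm => ⟨act_mem_posClosure hi hy hm.1, ?_⟩
      show M.par (M.act y m) ∈ posClosure N
      rw [M.par_act i y hy]
      exact Submodule.smul_mem _ _ (act_mem_posClosure hi hy hm.2)
    exact fun m hm => (h hm).2

/-- A family of subspaces that is shifted by the action of the homogeneous components bounds the
closure of a subspace of its degree zero member. -/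
lemma posClosure_le_sup {N : Submodule ℂ M.carrier} {A : ℤ → Submodule ℂ M.carrier}
    (hA : ∀ i j : ℤ, ∀ x ∈ gr i, ∀ m ∈ A j, M.act x m ∈ A (i + j)) {k : ℤ} (hN : N ≤ A k) :
    posClosure N ≤ N ⊔ ⨆ j : ℕ, A (k + 1 + j) := by
  refine posClosure_le le_sup_left fun i hi x hx m hm => ?_
  refine (le_sup_right : _ ≤ N ⊔ _) ?_
  -- Shifting by one matches the index `k + 1 + j` of the target: degree `e + 1` sends `A k` into
  -- its member with `j = e`.
  obtain ⟨i, rfl⟩ : ∃ e : ℕ, i = e + 1 := ⟨(i - 1).toNat, by omega⟩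
  obtain ⟨n, hn, m', hm', rfl⟩ := Submodule.mem_sup.1 hm
  rw [map_add]
  refine add_mem ?_ ?_
  · have h := hA _ _ x hx n (hN hn)
    exact Submodule.mem_iSup_of_mem i (by convert h using 2; ring)
  · clear hm
    induction hm' using Submodule.iSup_induction' with
    | mem j m hm =>
      have h := hA _ _ x hx m hm
      exact Submodule.mem_iSup_of_mem (i + 1 + j) (by convert h using 2; push_cast; ring)
    | zero => rw [map_zero]; exact zero_mem _
    | add m n _ _ hm hn => rw [map_add]; exact add_mem hm hn

/-! ### Simplicity of `Ψ(M)` -/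

lemma IsZGrading.par_eq {G : ℤ → Submodule ℂ M.carrier} (hG : M.IsZGrading G) (k : ℤ) :
    ∃ c : ℂ, ∀ m ∈ G k, M.par m = c • m := by
  rcases Int.even_or_odd' k with ⟨j, rfl | rfl⟩
  · refine ⟨1, fun m hm => Module.End.mem_eigenspace_iff.1 ?_⟩
    have h : G (2 * j) ≤ M.even := hG.even_eq ▸ le_iSup (fun k => G (2 * k)) j
    exact h hm
  · refine ⟨-1, fun m hm => Module.End.mem_eigenspace_iff.1 ?_⟩
    have h : G (2 * j + 1) ≤ M.odd := hG.odd_eq ▸ le_iSup (fun k => G (2 * k + 1)) j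
    exact h hm

/-- Parity is a scalar on each `G k`, so any subspace of one degree is automatically `ℤ/2`-graded.
This is needed because simplicity of `M` only rules out graded submodules. -/
lemma IsZGrading.par_mem {G : ℤ → Submodule ℂ M.carrier} (hG : M.IsZGrading G) {k : ℤ}
    {N : Submodule ℂ M.carrier} (hN : N ≤ G k) : ∀ m ∈ N, M.par m ∈ N := by
  obtain ⟨c, hc⟩ := hG.par_eq k
  intro m hm
  rw [hc m (hN hm)]
  exact N.smul_mem c hm

lemma IsZGrading.disjoint {G : ℤ → Submodule ℂ M.carrier} (hG : M.IsZGrading G) (k : ℤ) :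
    Disjoint (G k) (⨆ j : ℕ, G (k + 1 + j)) :=
  (hG.internal.submodule_iSupIndep k).mono_right <| iSup_le fun j =>
    le_iSup₂_of_le (k + 1 + j) (by omega) le_rfl

lemma act_mem_inv {x : W} (hx : x ∈ gr 0) {m : M.carrier} (hm : m ∈ M.inv) : M.act x m ∈ M.inv :=
  M.inv.lie_mem (x := (⟨x, hx⟩ : gl)) hm

lemma IsSimple.posClosure_eq_top (hS : M.IsSimple) {N : Submodule ℂ M.carrier}
    (hN : N ≤ M.inv.toSubmodule) (h0 : ∀ x ∈ gr 0, ∀ m ∈ N, M.act x m ∈ N)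
    (hp : ∀ m ∈ N, M.par m ∈ N) (hbot : N ≠ ⊥) : posClosure N = ⊤ :=
  (hS.eq_bot_or_top _ (posClosure_isSubmod hN h0 hp)).resolve_left fun h =>
    hbot (eq_bot_iff.2 (h ▸ le_posClosure N))

/-- A simple module in `𝕋_W^≤` is generated by any `gl(∞)`-submodule of its invariants, and these
are its component of least degree. -/
lemma IsSimple.exists_degree (hS : M.IsSimple) {G : ℤ → Submodule ℂ M.carrier}
    (hG : M.IsZGrading G) (hM : M.LAC gLE) :
    ∃ k, M.inv.toSubmodule ≤ G k ∧ ∀ N : Submodule ℂ M.carrier, N ≤ M.inv.toSubmodule →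
      (∀ x ∈ gr 0, ∀ m ∈ N, M.act x m ∈ N) → N ≠ ⊥ → N = M.inv.toSubmodule := by
  have := hS.nontrivial
  obtain ⟨k, v, hv, h0, hvi⟩ := exists_homogeneous_mem_inv hG hM
  set H : Submodule ℂ M.carrier := ⨆ j : ℕ, G (k + 1 + j) with hH
  have hact : ∀ i : ℤ, 0 ≤ i → ∀ x ∈ gr i, ∀ m ∈ H, M.act x m ∈ H := by
    intro i hi x hx m hm
    obtain ⟨i, rfl⟩ := Int.eq_ofNat_of_zero_le hi
    induction hm using Submodule.iSup_induction' with
    | mem j m hm =>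
      have h := hG.act_mem _ _ x hx m hm
      exact Submodule.mem_iSup_of_mem (i + j) (by convert h using 2; push_cast; ring)
    | zero => rw [map_zero]; exact zero_mem _
    | add m n _ _ hm hn => rw [map_add]; exact add_mem hm hn
  have hpar : ∀ m ∈ H, M.par m ∈ H := by
    intro m hm
    induction hm using Submodule.iSup_induction' with
    | mem j m hm => exact Submodule.mem_iSup_of_mem j (hG.par_mem le_rfl m hm)
    | zero => rw [map_zero]; exact zero_mem _
    | add m n _ _ hm hn => rw [map_add]; exact add_mem hm hn
  -- Nonzero invariants in degrees above `k` would generate all of `M` while staying inside `H`,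
  -- which does not contain `v`.
  have hinvH : M.inv.toSubmodule ⊓ H = ⊥ := by
    by_contra hne
    have htop := hS.posClosure_eq_top (N := M.inv.toSubmodule ⊓ H) inf_le_left
      (fun x hx m hm => ⟨act_mem_inv hx hm.1, hact 0 le_rfl x hx m hm.2⟩)
      (fun m hm => ⟨M.par_mem_inv m hm.1, hpar m hm.2⟩) hne
    have hle : posClosure (M.inv.toSubmodule ⊓ H) ≤ H :=
      posClosure_le inf_le_right fun i hi => hact i (by omega)
    rw [htop] at hle
    exact h0 (Submodule.disjoint_def.1 (hG.disjoint k) v hv (hle trivial))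
  -- As `N` generates `M`, any invariant is an element of `N` plus a vector of `H`. The latter is a
  -- difference of invariants, hence zero.
  have key : ∀ N : Submodule ℂ M.carrier, N ≤ M.inv.toSubmodule → N ≤ G k →
      (∀ x ∈ gr 0, ∀ m ∈ N, M.act x m ∈ N) → N ≠ ⊥ → N = M.inv.toSubmodule := by
    intro N hN hNk hN0 hne
    refine le_antisymm hN fun w hw => ?_
    have htop := hS.posClosure_eq_top hN hN0 (hG.par_mem hNk) hne
    have hle := posClosure_le_sup hG.act_mem hNk
    rw [htop] at hle
    obtain ⟨n, hn, w', hw', rfl⟩ := Submodule.mem_sup.1 (hle (show w ∈ ⊤ from trivial))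
    have : w' ∈ M.inv.toSubmodule ⊓ H := ⟨by simpa using sub_mem hw (hN hn), hw'⟩
    rw [hinvH, Submodule.mem_bot] at this
    rwa [this, add_zero]
  -- Applied to the invariants of degree `k`, which include `v`, the previous claim removes the
  -- assumption on degree.
  have hk : M.inv.toSubmodule ≤ G k := by
    refine inf_eq_left.1 (key _ inf_le_left inf_le_right (fun x hx m hm =>
      ⟨act_mem_inv hx hm.1, by simpa using hG.act_mem 0 k x hx m hm.2⟩) fun h => h0 ?_)
    have : v ∈ M.inv.toSubmodule ⊓ G k := ⟨hvi, hv⟩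
    rwa [h, Submodule.mem_bot] at this
  exact ⟨k, hk, fun N hN => key N hN (hN.trans hk)⟩

/-- The inclusion of `Ψ(M)` into `M`. -/
def PsiIncl (M : WMod.{u}) : M.Psi.carrier →ₗ[ℂ] M.carrier := M.inv.toSubmodule.subtype

lemma PsiIncl_injective : Function.Injective M.PsiIncl := Subtype.val_injective

lemma PsiIncl_mem (m : M.Psi.carrier) : M.PsiIncl m ∈ M.inv := m.2

lemma PsiIncl_lie (a : gl) (m : M.Psi.carrier) : M.PsiIncl ⁅a, m⁆ = M.act (toW a) (M.PsiIncl m) :=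
  rfl

lemma PsiIncl_par (m : M.Psi.carrier) : M.PsiIncl (M.Psi.par m) = M.par (M.PsiIncl m) := rfl

lemma nontrivial_Psi (hM : M.MemTWle) [Nontrivial M.carrier] : Nontrivial M.Psi.carrier := by
  obtain ⟨G, hG⟩ := hM.graded
  obtain ⟨k, v, -, h0, hv⟩ := exists_homogeneous_mem_inv hG hM.lac
  exact ⟨⟨⟨v, hv⟩, 0, fun h => h0 (congrArg Subtype.val h)⟩⟩

/-- A `gl(∞)`-submodule need not be graded a priori; this is harmless because all of `Ψ(M)` lies in
one degree of `M`. -/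
lemma IsSimple.isIrreducible_Psi (hS : M.IsSimple) (hM : M.MemTWle) :
    LieModule.IsIrreducible ℂ gl M.Psi.carrier := by
  have := hS.nontrivial
  have := nontrivial_Psi hM
  obtain ⟨G, hG⟩ := hM.graded
  obtain ⟨-, -, h⟩ := hS.exists_degree hG hM.lac
  refine LieModule.IsIrreducible.mk fun N hN => ?_
  have hN' : N.toSubmodule.map M.PsiIncl = M.inv.toSubmodule := by
    refine h _ ?_ ?_ fun hb => hN ?_
    · rintro _ ⟨m, -, rfl⟩
      exact PsiIncl_mem m
    · rintro x hx _ ⟨m, hm, rfl⟩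
      exact ⟨⁅(⟨x, hx⟩ : gl), m⁆, N.lie_mem hm, rfl⟩
    · rw [← LieSubmodule.toSubmodule_eq_bot]
      exact Submodule.map_injective_of_injective PsiIncl_injective
        (hb.trans (Submodule.map_bot _).symm)
  refine eq_top_iff.2 fun m _ => ?_
  obtain ⟨m', hm', h⟩ : M.PsiIncl m ∈ N.toSubmodule.map M.PsiIncl := hN' ▸ PsiIncl_mem m
  rwa [← PsiIncl_injective h]

lemma memTgl_Psi (hM : M.MemTWle) (hirr : LieModule.IsIrreducible ℂ gl M.Psi.carrier) :
    MemTgl M.Psi.carrier where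
  finite_length := by
    -- The composition series is `⊥ ⋖ ⊤`, of length one.
    refine ⟨⟨1, fun i => if i = 0 then ⊥ else ⊤, ?_⟩, rfl, rfl⟩
    intro i
    obtain rfl : i = 0 := Subsingleton.elim _ _
    exact bot_covBy_top
  integrable a m := by
    let f := M.PsiIncl
    have hpow : ∀ i : ℕ, f ((LieModule.toEnd ℂ gl M.Psi.carrier a ^ i) m)
        = (LieModule.toEnd ℂ gl M.carrier a ^ i) (f m) := by
      intro i
      induction i with
      | zero => rfl
      | succ i ih =>
        rw [pow_succ', pow_succ', Module.End.mul_apply, Module.End.mul_apply, ← ih]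
        rfl
    have hfin := hM.integrable a (f m)
    have h : (Submodule.span ℂ (Set.range fun i : ℕ =>
        ((LieModule.toEnd ℂ gl M.Psi.carrier a) ^ i) m)).map f = Submodule.span ℂ
          (Set.range fun i : ℕ => ((LieModule.toEnd ℂ gl M.carrier a) ^ i) (f m)) := by
      rw [Submodule.map_span, ← Set.range_comp]
      congr 2
      exact funext hpow
    rw [← h] at hfin
    exact LinearEquiv.finiteDimensional
      (Submodule.equivMapOfInjective f PsiIncl_injective _).symm
  lac m := by
    obtain ⟨n, hn⟩ := hM.lac (M.PsiIncl m)
    exact ⟨n, fun a ha => PsiIncl_injective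
      (hn (toW a) ⟨toW_mem_tW ha, (le_sup_right : gr 0 ≤ gLE) (toW_mem a)⟩)⟩

end WMod

end WInf

namespace WInf

namespace WMod

variable {M : WMod.{u}}

/-! ### Generalized degrees -/

/-- The subspace of vectors on which the truncated Euler fields eventually act as the scalar `c`. -/
def eulerSpace (M : WMod.{u}) (c : ℂ) : Submodule ℂ M.carrier where
  carrier := {m | ∀ᶠ N in Filter.atTop, M.act (toW (euler N)) m = c • m}
  zero_mem' := Filter.Eventually.of_forall fun N => by rw [map_zero, smul_zero]
  add_mem' {m n} hm hn := by
    filter_upwards [hm, hn] with N hm hn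
    rw [map_add, hm, hn, smul_add]
  smul_mem' a m hm := by
    filter_upwards [hm] with N hm
    rw [map_smul, hm, smul_comm]

lemma mem_eulerSpace {c : ℂ} {m : M.carrier} :
    m ∈ M.eulerSpace c ↔ ∀ᶠ N in Filter.atTop, M.act (toW (euler N)) m = c • m := Iff.rfl

/-- For large `N` the bracket of `euler N` with `x` is `i • x`, so moving `euler N` past `x` adds
`i` to the eigenvalue. -/
lemma act_mem_eulerSpace {i : ℤ} {x : W} (hx : x ∈ gr i) {c : ℂ} {m : M.carrier}
    (hm : m ∈ M.eulerSpace c) : M.act x m ∈ M.eulerSpace (c + i) := by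
  refine mem_eulerSpace.2 ?_
  filter_upwards [mem_eulerSpace.1 hm, br_euler_eventually hx] with N hm hN
  have h := M.act_br 0 i _ (toW_mem (euler N)) x hx m
  rw [hN, hm, zero_mul, zpow_zero, one_smul, map_smul, map_smul, LinearMap.smul_apply] at h
  rw [add_smul, h, add_sub_cancel]

lemma act_E_comm (i j : ℕ) (m : M.carrier) :
    M.act (toW (E i i)) (M.act (toW (E j j)) m) = M.act (toW (E j j)) (M.act (toW (E i i)) m) := by
  have h : ⁅E i i, E j j⁆ = 0 := by
    rw [E_lie]
    by_cases hij : i = j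
    · subst hij; simp
    · simp [hij, Ne.symm hij]
  have h' := leibniz_lie (E i i) (E j j) m
  rw [h, zero_lie, zero_add] at h'
  exact h'

/-- An integrable module with large annihilators contains an eigenvector of all sufficiently large
truncated Euler fields in each nonzero `gl(∞)`-stable subspace. -/
lemma exists_mem_eulerSpace (hM : M.MemTWle) {m : M.carrier} (h0 : m ≠ 0)
    {N : Submodule ℂ M.carrier} (hm : m ∈ N) (hN : ∀ x ∈ gr 0, ∀ m ∈ N, M.act x m ∈ N) :
    ∃ c, ∃ v ∈ N, v ≠ 0 ∧ v ∈ M.eulerSpace c := by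
  obtain ⟨n, hn⟩ := hM.lac m
  have hfin := hM.integrable (euler n) m
  let e : Module.End ℂ M.carrier := LieModule.toEnd ℂ gl M.carrier (euler n)
  let S : Submodule ℂ M.carrier := Submodule.span ℂ (Set.range fun i : ℕ => (e ^ i) m)
  have he : ∀ v ∈ S, e v ∈ S := by
    have : S ≤ S.comap e := Submodule.span_le.2 (by
      rintro _ ⟨i, rfl⟩
      refine Submodule.subset_span ⟨i + 1, ?_⟩
      simp only [pow_succ']
      rfl)
    exact this
  -- Vectors of `N` killed by every `E_{i,i}` with `i ≥ n`. The diagonal units commute, so `e`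
  -- preserves `T`; hence the finite-dimensional space `S` generated from `m` lies in it, and so
  -- does any eigenvector of `e` in `S`.
  let T : Submodule ℂ M.carrier := N ⊓ ⨅ i : Set.Ici n, LinearMap.ker (M.act (toW (E i i)))
  have hT : ∀ v ∈ T, e v ∈ T := by
    refine fun v hv => ⟨hN _ (toW_mem _) v hv.1, (Submodule.mem_iInf _).2 fun i => ?_⟩
    have h := LinearMap.mem_ker.1 ((Submodule.mem_iInf _).1 hv.2 i)
    have : e v = ∑ j ∈ Finset.range n, M.act (toW (E j j)) v := by
      show M.act (toW (euler n)) v = _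
      rw [euler, map_sum, map_sum, LinearMap.sum_apply]
    rw [LinearMap.mem_ker, this, map_sum]
    refine Finset.sum_eq_zero fun j _ => ?_
    rw [act_E_comm i, h, map_zero]
  have hST : S ≤ T := by
    refine Submodule.span_le.2 ?_
    rintro _ ⟨i, rfl⟩
    induction i with
    | zero =>
      refine ⟨hm, (Submodule.mem_iInf _).2 fun i => LinearMap.mem_ker.2 ?_⟩
      exact hn _ ⟨E_mem_tW i.2 i.2, (le_sup_right : gr 0 ≤ gLE) (toW_mem _)⟩
    | succ i ih =>
      have h := hT _ ih
      rwa [show e ((e ^ i) m) = (e ^ (i + 1)) m by rw [pow_succ']; rfl] at h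
  have hmS : m ∈ S := Submodule.subset_span ⟨0, by simp⟩
  have : Nontrivial S := ⟨⟨⟨m, hmS⟩, 0, fun h => h0 (congrArg Subtype.val h)⟩⟩
  have : FiniteDimensional ℂ S := hfin
  obtain ⟨c, hc⟩ := Module.End.exists_eigenvalue (e.restrict he)
  obtain ⟨v, hv⟩ := hc.exists_hasEigenvector
  have hev : e v = c • (v : M.carrier) := congrArg Subtype.val hv.apply_eq_smul
  refine ⟨c, v, (hST v.2).1, fun h => hv.2 (Subtype.ext h), ?_⟩
  refine mem_eulerSpace.2 ?_
  filter_upwards [Filter.eventually_ge_atTop n] with k hk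
  -- The extra summands of `euler k` have index at least `n` and kill `v`.
  have hsum : M.act (toW (euler k)) (v : M.carrier) = M.act (toW (euler n)) v := by
    simp only [euler, map_sum, LinearMap.sum_apply]
    refine (Finset.sum_subset (Finset.range_mono hk) fun i _ hi => ?_).symm
    exact LinearMap.mem_ker.1 ((Submodule.mem_iInf _).1 (hST v.2).2 ⟨i, by simpa using hi⟩)
  exact hsum.trans hev

/-- Some invariant is an eventual Euler eigenvector, and eventual eigenspaces are `𝔤^0`-stable since
`𝔤^0` has degree zero. Simplicity of `Ψ(M)` then spreads the eigenvalue to all invariants, as in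
Schur's lemma. -/
lemma IsSimple.inv_le_eulerSpace (hS : M.IsSimple) (hM : M.MemTWle) :
    ∃ c, M.inv.toSubmodule ≤ M.eulerSpace c := by
  have := hS.nontrivial
  obtain ⟨G, hG⟩ := hM.graded
  obtain ⟨-, m, -, h0, hm⟩ := exists_homogeneous_mem_inv hG hM.lac
  obtain ⟨-, -, h⟩ := hS.exists_degree hG hM.lac
  obtain ⟨c, v, hv, hv0, hvc⟩ := exists_mem_eulerSpace hM h0 (N := M.inv.toSubmodule) hm
    fun x hx m hm => act_mem_inv hx hm
  refine ⟨c, inf_eq_left.1 (h _ inf_le_left (fun x hx m hm => ⟨act_mem_inv hx hm.1, ?_⟩) ?_)⟩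
  · simpa using act_mem_eulerSpace hx hm.2
  · exact (Submodule.ne_bot_iff _).2 ⟨v, ⟨hv, hvc⟩, hv0⟩

/-- A submodule that contains `m₀ + m`, where `m₀` has generalized degree `c` and `m` is a sum of
vectors of generalized degrees `c + 1, c + 2, …`, contains `m₀`. -/
lemma IsSubmod.mem_of_add_mem {S : Submodule ℂ M.carrier} (hS : M.IsSubmod S) {c : ℂ}
    {m₀ m : M.carrier} (h₀ : m₀ ∈ M.eulerSpace c)
    (hm : m ∈ ⨆ j : ℕ, M.eulerSpace (c + (j + 1))) (h : m₀ + m ∈ S) : m₀ ∈ S := by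
  -- Apply the product of the operators `euler N - (c + j + 1)`.
  have key : ∀ J : ℕ, ∀ m₀ ∈ M.eulerSpace c,
      ∀ m ∈ ⨆ j : Fin J, M.eulerSpace (c + ((j : ℕ) + 1)), m₀ + m ∈ S → m₀ ∈ S := by
    intro J
    induction J with
    | zero =>
      intro m₀ _ m hm h
      rw [iSup_of_empty, Submodule.mem_bot] at hm
      rwa [hm, add_zero] at h
    | succ J ih =>
      intro m₀ h₀ m hm h
      -- One factor of the product kills the top term `j = J` and rescales the others.
      have hsplit : ∀ᶠ N in Filter.atTop, M.act (toW (euler N)) m - (c + (J + 1)) • m ∈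
          ⨆ j : Fin J, M.eulerSpace (c + ((j : ℕ) + 1)) := by
        clear h
        induction hm using Submodule.iSup_induction' with
        | mem j m hm =>
          filter_upwards [mem_eulerSpace.1 hm] with N hN
          rw [hN, ← sub_smul]
          rcases Fin.eq_castSucc_or_eq_last j with ⟨j, rfl⟩ | rfl
          · exact Submodule.smul_mem _ _ (Submodule.mem_iSup_of_mem j hm)
          · simp
        | zero =>
          filter_upwards with N
          simp
        | add m n _ _ hm hn =>
          filter_upwards [hm, hn] with N hm hn
          have := add_mem hm hn
          rwa [show ∀ a b d e : M.carrier, a - b + (d - e) = (a + d) - (b + e) from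
            fun a b d e => by abel, ← map_add, ← smul_add] at this
      obtain ⟨N, hN, hN₀⟩ := (hsplit.and (mem_eulerSpace.1 h₀)).exists
      -- The same factor multiplies `m₀` by `c - (c + J + 1)`, which is nonzero in characteristic
      -- zero.
      have hne : (-((J : ℂ) + 1)) ≠ 0 := neg_ne_zero.2 (Nat.cast_add_one_ne_zero J)
      refine (S.smul_mem_iff hne).1 (ih _ (Submodule.smul_mem _ _ h₀) _ hN ?_)
      have hmem := sub_mem (hS.act_mem (toW (euler N)) _ h) (S.smul_mem (c + (J + 1)) h)
      rw [map_add, hN₀] at hmem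
      convert hmem using 1
      module
  obtain ⟨J, hJ⟩ : ∃ J : ℕ, m ∈ ⨆ j : Fin J, M.eulerSpace (c + ((j : ℕ) + 1)) := by
    clear h
    have mono : ∀ {J J' : ℕ}, J ≤ J' → ⨆ j : Fin J, M.eulerSpace (c + ((j : ℕ) + 1)) ≤
        ⨆ j : Fin J', M.eulerSpace (c + ((j : ℕ) + 1)) := fun hJ =>
      iSup_le fun j => le_iSup_of_le (Fin.castLE hJ j) le_rfl
    induction hm using Submodule.iSup_induction' with
    | mem j m hm => exact ⟨j + 1, Submodule.mem_iSup_of_mem (Fin.last j) hm⟩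
    | zero => exact ⟨0, zero_mem _⟩
    | add m n _ _ hm hn =>
      obtain ⟨J, hJ⟩ := hm
      obtain ⟨J', hJ'⟩ := hn
      exact ⟨max J J', add_mem (mono (le_max_left _ _) hJ) (mono (le_max_right _ _) hJ')⟩
  exact key J m₀ h₀ m hJ h

/-! ### The action of `U(𝔤)` -/

/-- The action of `U(𝔤)` on a `𝔤`-module. -/
def actU (M : WMod.{u}) : U →ₐ[ℂ] Module.End ℂ M.carrier :=
  liftU M.act fun k l x hx y hy => by
    refine LinearMap.ext fun m => ?_
    rw [LinearMap.add_apply, LinearMap.smul_apply, Module.End.mul_apply, Module.End.mul_apply,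
      act_act hx hy, add_comm]

lemma actU_toU (x : W) : M.actU (toU x) = M.act x := liftU_toU _ _ x

end WMod

/-- The elements whose left multiplication preserves `p` form a subalgebra `T` containing the image
of `𝔤`. By the universal property the identity of `U(𝔤)` factors through `T`, so `T` is everything.
-/
lemma U_induction {p : U → Prop} (one : p 1) (mul : ∀ x u, p u → p (toU x * u))
    (add : ∀ u v, p u → p v → p (u + v)) (smul : ∀ (c : ℂ) u, p u → p (c • u)) (u : U) : p u := by
  have hzero : p 0 := by simpa using smul 0 1 one
  let S : Submodule ℂ U :=
    { carrier := {u | p u}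
      add_mem' := fun {u v} => add u v
      zero_mem' := hzero
      smul_mem' := smul }
  let T : Subalgebra ℂ U :=
    { carrier := {w | ∀ u, p u → p (w * u)}
      mul_mem' := fun {v w} hv hw u hu => by rw [mul_assoc]; exact hv _ (hw u hu)
      add_mem' := fun {v w} hv hw u hu => by rw [add_mul]; exact add _ _ (hv u hu) (hw u hu)
      algebraMap_mem' := fun c u hu => by rw [← Algebra.smul_def]; exact smul c u hu }
  let f : U →ₐ[ℂ] T := liftU
    ({ toFun := fun x => ⟨toU x, mul x⟩
       map_add' := fun x y => Subtype.ext (map_add toU x y)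
       map_smul' := fun c x => Subtype.ext (map_smul toU c x) } : W →ₗ[ℂ] T)
    fun k l x hx y hy => Subtype.ext (toU_mul hx hy)
  have hf : T.val.comp f = AlgHom.id ℂ U := U_hom_ext fun x => by
    rw [AlgHom.comp_apply, liftU_toU]
    rfl
  have hu : u ∈ T := by
    have := (f u).2
    rwa [show ((f u : T) : U) = u from DFunLike.congr_fun hf u] at this
  simpa using hu 1 one

namespace WMod

variable {M : WMod.{u}}

lemma actU_par (u : U) (m : M.carrier) : M.actU (parU u) (M.par m) = M.par (M.actU u m) := by
  induction u using U_induction with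
  | one => simp
  | mul x u h =>
    have hx : x ∈ ⨆ k, gr k := by rw [iSup_gr]; trivial
    rw [map_mul, map_mul, map_mul, parU_toU, actU_toU, actU_toU, Module.End.mul_apply,
      Module.End.mul_apply, h]
    generalize M.actU u m = n
    induction hx using Submodule.iSup_induction' with
    | mem k x hx => rw [parW_of_mem hx, M.par_act k x hx, map_smul, LinearMap.smul_apply]
    | zero => simp
    | add x y _ _ hx hy =>
      simp only [map_add, LinearMap.add_apply, hx, hy]
  | add u v hu hv => simp only [map_add, LinearMap.add_apply, hu, hv]
  | smul c u hu => simp only [map_smul, LinearMap.smul_apply, hu]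

end WMod

/-! ### The induced module `K^-(X)` and its generation by `X`. -/

namespace GlMod

variable {X : GlMod.{u}}

/-- The quotient map from `U(𝔤) ⊗ X` to `K^-(X)`. -/
def mkK (X : GlMod.{u}) : U ⊗[ℂ] X.carrier →ₗ[ℂ] X.KMinus.carrier := X.indRel.mkQ

lemma mkK_surjective (X : GlMod.{u}) : Function.Surjective X.mkK := X.indRel.mkQ_surjective

/-- The canonical map from `X` to `K^-(X)`. -/
def inclK (X : GlMod.{u}) : X.carrier →ₗ[ℂ] X.KMinus.carrier :=
  X.mkK ∘ₗ TensorProduct.mk ℂ U X.carrier 1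

lemma inclK_lie (a : gl) (x : X.carrier) : X.KMinus.act (toW a) (X.inclK x) = X.inclK ⁅a, x⁆ := by
  refine (Submodule.Quotient.eq _).2 (Submodule.subset_span (Or.inl ⟨1, a, x, ?_⟩))
  show (toU (toW a) * 1) ⊗ₜ[ℂ] x - _ = _
  rw [one_mul, mul_one]
  rfl

lemma inclK_mem_inv (x : X.carrier) : X.inclK x ∈ X.KMinus.inv := by
  intro b hb
  refine (Submodule.Quotient.mk_eq_zero _).2 (Submodule.subset_span (Or.inr ⟨1, b, x, hb, ?_⟩))
  show (toU b * 1) ⊗ₜ[ℂ] x = _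
  rw [one_mul, mul_one]

lemma inclK_par (x : X.carrier) : X.KMinus.par (X.inclK x) = X.inclK (X.par x) := by
  show X.mkK (parU 1 ⊗ₜ[ℂ] X.par x) = _
  rw [map_one]
  rfl

lemma actU_inclK (u : U) (x : X.carrier) :
    X.KMinus.actU u (X.inclK x) = X.mkK (u ⊗ₜ[ℂ] x) := by
  induction u using U_induction with
  | one => rw [map_one]; rfl
  | mul y u h =>
    rw [map_mul, Module.End.mul_apply, h, WMod.actU_toU]
    rfl
  | add u v hu hv => rw [map_add, LinearMap.add_apply, hu, hv, TensorProduct.add_tmul, map_add]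
  | smul c u hu => rw [map_smul, LinearMap.smul_apply, hu, ← map_smul, TensorProduct.smul_tmul']

lemma _root_.WInf.WMod.IsSubmod.actU_mem {M : WMod.{u}} {S : Submodule ℂ M.carrier}
    (hS : M.IsSubmod S) (u : U) {m : M.carrier} (hm : m ∈ S) : M.actU u m ∈ S := by
  induction u using U_induction with
  | one => simpa using hm
  | mul x u h =>
    rw [map_mul, Module.End.mul_apply, WMod.actU_toU]
    exact hS.act_mem x _ h
  | add u v hu hv => rw [map_add]; exact add_mem hu hv
  | smul c u hu => rw [map_smul]; exact S.smul_mem c hu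

/-- `K^-(X)` is generated by `X`. -/
lemma eq_top_of_inclK_mem {S : Submodule ℂ X.KMinus.carrier} (hS : X.KMinus.IsSubmod S)
    (h : ∀ x, X.inclK x ∈ S) : S = ⊤ := by
  refine eq_top_iff.2 fun z _ => ?_
  obtain ⟨z, rfl⟩ := X.mkK_surjective z
  clear * - hS h
  induction z with
  | zero => rw [map_zero]; exact zero_mem _
  | add y z hy hz => rw [map_add]; exact add_mem hy hz
  | tmul u x =>
    rw [← actU_inclK]
    exact hS.actU_mem u (h x)

end GlMod

/-! ### The canonical map `K^-(Ψ(M)) → M` and its kernel. -/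

namespace WMod

variable {M : WMod.{u}}

/-- The canonical `𝔤`-linear map from `K^-(Ψ(M))` to `M`. -/
def counit (M : WMod.{u}) : M.Psi.KMinus.carrier →ₗ[ℂ] M.carrier :=
  M.Psi.indRel.liftQ (TensorProduct.lift (M.actU.toLinearMap.compl₂ M.PsiIncl)) <| by
    refine Submodule.span_le.2 ?_
    rintro _ (⟨u, a, x, rfl⟩ | ⟨u, b, x, hb, rfl⟩)
    · show TensorProduct.lift (M.actU.toLinearMap.compl₂ M.PsiIncl) _ = 0
      rw [map_sub, TensorProduct.lift.tmul, TensorProduct.lift.tmul]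
      show M.actU (u * toU (toW a)) (M.PsiIncl x) - M.actU u (M.PsiIncl ⁅a, x⁆) = 0
      rw [map_mul, Module.End.mul_apply, actU_toU, PsiIncl_lie, sub_self]
    · show TensorProduct.lift (M.actU.toLinearMap.compl₂ M.PsiIncl) _ = 0
      rw [TensorProduct.lift.tmul]
      show M.actU (u * toU b) (M.PsiIncl x) = 0
      rw [map_mul, Module.End.mul_apply, actU_toU, PsiIncl_mem x b hb, map_zero]

lemma counit_mkK (u : U) (x : M.Psi.carrier) :
    M.counit (M.Psi.mkK (u ⊗ₜ[ℂ] x)) = M.actU u (M.PsiIncl x) := rfl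

lemma counit_inclK (x : M.Psi.carrier) : M.counit (M.Psi.inclK x) = M.PsiIncl x := by
  refine (counit_mkK 1 x).trans ?_
  rw [map_one]
  rfl

lemma counit_act (y : W) (z : M.Psi.KMinus.carrier) :
    M.counit (M.Psi.KMinus.act y z) = M.act y (M.counit z) := by
  obtain ⟨z, rfl⟩ := M.Psi.mkK_surjective z
  induction z with
  | zero => simp only [map_zero]
  | add y z hy hz => simp only [map_add, hy, hz]
  | tmul u x =>
    refine (counit_mkK (toU y * u) x).trans ?_
    rw [counit_mkK, map_mul, Module.End.mul_apply, actU_toU]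

lemma counit_par (z : M.Psi.KMinus.carrier) :
    M.counit (M.Psi.KMinus.par z) = M.par (M.counit z) := by
  obtain ⟨z, rfl⟩ := M.Psi.mkK_surjective z
  induction z with
  | zero => simp only [map_zero]
  | add y z hy hz => simp only [map_add, hy, hz]
  | tmul u x =>
    refine (counit_mkK (parU u) (M.Psi.par x)).trans ?_
    rw [counit_mkK, PsiIncl_par, actU_par]

lemma IsSubmod.map_counit {S : Submodule ℂ M.Psi.KMinus.carrier} (hS : M.Psi.KMinus.IsSubmod S) :
    M.IsSubmod (S.map M.counit) where
  act_mem := by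
    rintro x _ ⟨m, hm, rfl⟩
    exact ⟨_, hS.act_mem x m hm, counit_act x m⟩
  par_mem := by
    rintro _ ⟨m, hm, rfl⟩
    exact ⟨_, hS.par_mem m hm, counit_par m⟩

lemma isSubmod_ker_counit : M.Psi.KMinus.IsSubmod (LinearMap.ker M.counit) where
  act_mem x m hm := by
    rw [LinearMap.mem_ker] at hm ⊢
    rw [counit_act, hm, map_zero]
  par_mem m hm := by
    rw [LinearMap.mem_ker] at hm ⊢
    rw [counit_par, hm, map_zero]

lemma isSubmod_top : M.IsSubmod ⊤ := ⟨fun _ _ _ => trivial, fun _ _ => trivial⟩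

/-- The image is a submodule containing `Ψ(M)`, which is nonzero by part (a). -/
lemma IsSimple.counit_surjective (hS : M.IsSimple) (hM : M.MemTWle) :
    Function.Surjective M.counit := by
  have := hS.nontrivial
  have := nontrivial_Psi hM
  obtain ⟨x, hx⟩ := exists_ne (0 : M.Psi.carrier)
  rw [← LinearMap.range_eq_top, LinearMap.range_eq_map]
  refine (hS.eq_bot_or_top _ isSubmod_top.map_counit).resolve_left fun h => hx ?_
  have : M.PsiIncl x ∈ (⊤ : Submodule ℂ M.Psi.KMinus.carrier).map M.counit :=
    ⟨M.Psi.inclK x, trivial, counit_inclK x⟩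
  rw [h, Submodule.mem_bot] at this
  exact PsiIncl_injective (this.trans (map_zero _).symm)

/-- Every proper submodule of `K^-(Ψ(M))` lies in the kernel of the canonical map to `M`. -/
lemma IsSimple.le_ker_counit (hS : M.IsSimple) (hM : M.MemTWle)
    {S : Submodule ℂ M.Psi.KMinus.carrier} (h : M.Psi.KMinus.IsSubmod S) (hne : S ≠ ⊤) :
    S ≤ LinearMap.ker M.counit := by
  rw [LinearMap.le_ker_iff_map]
  refine (hS.eq_bot_or_top _ h.map_counit).resolve_right fun htop => hne ?_
  have := hS.nontrivial
  have := nontrivial_Psi hM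
  have hirr := hS.isIrreducible_Psi hM
  obtain ⟨G, hG⟩ := hM.graded
  obtain ⟨k, hk, -⟩ := hS.exists_degree hG hM.lac
  obtain ⟨c, hc⟩ := hS.inv_le_eulerSpace hM
  obtain ⟨v, hv⟩ := exists_ne (0 : M.Psi.carrier)
  obtain ⟨s, hs, hsv⟩ : M.PsiIncl v ∈ S.map M.counit := htop ▸ trivial
  -- `K^-(Ψ(M))` is graded by `A`, and the canonical map respects the degrees
  let A : ℤ → Submodule ℂ M.Psi.KMinus.carrier := fun j =>
    M.Psi.KMinus.eulerSpace (c + j) ⊓ (G (k + j)).comap M.counit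
  have hA : ∀ i j : ℤ, ∀ x ∈ gr i, ∀ m ∈ A j, M.Psi.KMinus.act x m ∈ A (i + j) := by
    refine fun i j x hx m hm => Submodule.mem_inf.2 ⟨?_, ?_⟩
    · rw [show c + ((i + j : ℤ) : ℂ) = c + j + i by push_cast; ring]
      exact act_mem_eulerSpace hx hm.1
    · rw [Submodule.mem_comap, counit_act, show k + (i + j) = i + (k + j) by ring]
      exact hG.act_mem _ _ x hx _ hm.2
  let R := LinearMap.range M.Psi.inclK
  have hRA : R ≤ A 0 := by
    rintro _ ⟨x, rfl⟩
    refine Submodule.mem_inf.2 ⟨mem_eulerSpace.2 ?_, ?_⟩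
    · filter_upwards [mem_eulerSpace.1 (hc (PsiIncl_mem x))] with N hN
      rw [GlMod.inclK_lie, Int.cast_zero, add_zero, ← map_smul]
      congr 1
      exact PsiIncl_injective hN
    · rw [Submodule.mem_comap, counit_inclK, add_zero]
      exact hk (PsiIncl_mem x)
  -- The closure is a submodule containing the generators, so `K^-(Ψ(M))` is the sum of `R` and the
  -- `A j` with `j ≥ 1`.
  have hRtop : posClosure R = ⊤ := by
    refine GlMod.eq_top_of_inclK_mem (posClosure_isSubmod ?_ ?_ ?_) fun x =>
      le_posClosure R ⟨x, rfl⟩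
    · rintro _ ⟨x, rfl⟩
      exact GlMod.inclK_mem_inv x
    · rintro a ha _ ⟨x, rfl⟩
      exact ⟨_, (GlMod.inclK_lie ⟨a, ha⟩ x).symm⟩
    · rintro _ ⟨x, rfl⟩
      exact ⟨_, (GlMod.inclK_par x).symm⟩
  have hdec := posClosure_le_sup hA hRA
  rw [hRtop] at hdec
  obtain ⟨_, ⟨x, rfl⟩, t, ht, rfl⟩ := Submodule.mem_sup.1 (hdec (show s ∈ ⊤ from trivial))
  have htG : M.counit t ∈ ⨆ j : ℕ, G (k + 1 + j) := by
    refine (iSup_le fun j => ?_ : (⨆ j : ℕ, A (0 + 1 + j)) ≤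
      (⨆ j : ℕ, G (k + 1 + j)).comap M.counit) ht
    refine fun m hm => Submodule.mem_iSup_of_mem j ?_
    have h := hm.2
    rwa [zero_add, ← add_assoc] at h
  have hte : t ∈ ⨆ j : ℕ, M.Psi.KMinus.eulerSpace (c + (j + 1)) := by
    refine (iSup_le fun j => ?_ : (⨆ j : ℕ, A (0 + 1 + j)) ≤ _) ht
    refine fun m hm => Submodule.mem_iSup_of_mem j ?_
    have h := hm.1
    rwa [show c + ((0 + 1 + j : ℤ) : ℂ) = c + (j + 1) by push_cast; ring] at h
  -- The image of `t` equals `v - x`, which lies in degree `k`, whereas `t` maps to degrees above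
  -- `k`; both are therefore zero.
  have hxv : x = v := by
    rw [map_add, counit_inclK] at hsv
    have h1 : M.counit t = M.PsiIncl (v - x) := by rw [map_sub, ← hsv, add_sub_cancel_left]
    rw [h1] at htG
    have h2 := Submodule.disjoint_def.1 (hG.disjoint k) _ (hk (PsiIncl_mem _)) htG
    have h3 : v - x = 0 := PsiIncl_injective (h2.trans (map_zero _).symm)
    exact (sub_eq_zero.1 h3).symm
  -- `S` is not known to be `ℤ`-graded; the Euler eigenvalues extract the lowest component instead.
  have hxS : M.Psi.inclK x ∈ S := by
    refine h.mem_of_add_mem (c := c) ?_ hte hs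
    simpa using (hRA ⟨x, rfl⟩).1
  -- The part of `Ψ(M)` that lands in `S` is a `gl(∞)`-submodule containing `v ≠ 0`, hence
  -- everything.
  let Y : LieSubmodule ℂ gl M.Psi.carrier :=
    { S.comap M.Psi.inclK with
      lie_mem := fun {a y} hy => by
        show M.Psi.inclK ⁅a, y⁆ ∈ S
        rw [← GlMod.inclK_lie]
        exact h.act_mem _ _ hy }
  have hY : Y = ⊤ := (eq_bot_or_eq_top Y).resolve_left fun hY => hv <| by
    have : v ∈ Y := hxv ▸ hxS
    rwa [hY, LieSubmodule.mem_bot] at this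
  refine GlMod.eq_top_of_inclK_mem h fun y => ?_
  have : y ∈ Y := hY ▸ LieSubmodule.mem_top y
  exact this

/-- The kernel is itself proper, because the map is onto a nonzero module, and it contains every
proper submodule. -/
lemma IsSimple.ker_counit (hS : M.IsSimple) (hM : M.MemTWle) :
    LinearMap.ker M.counit = M.Psi.maxSub := by
  refine le_antisymm (le_sSup ⟨isSubmod_ker_counit, fun h => ?_⟩)
    (sSup_le fun S h => hS.le_ker_counit hM h.1 h.2)
  have := hS.nontrivial
  obtain ⟨m, hm⟩ := exists_ne (0 : M.carrier)
  obtain ⟨z, rfl⟩ := hS.counit_surjective hM m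
  exact hm (LinearMap.mem_ker.1 (h ▸ trivial))

lemma IsSimple.nonempty_iso (hS : M.IsSimple) (hM : M.MemTWle) :
    Nonempty (Iso M M.Psi.LMinus) := by
  let e : (M.Psi.KMinus.carrier ⧸ M.Psi.maxSub) ≃ₗ[ℂ] M.carrier :=
    (Submodule.quotEquivOfEq _ _ (hS.ker_counit hM).symm).trans
      (M.counit.quotKerEquivOfSurjective (hS.counit_surjective hM))
  have he : ∀ z, e.symm (M.counit z) = M.Psi.maxSub.mkQ z := fun z => by
    rw [LinearEquiv.symm_apply_eq]
    rfl
  refine ⟨⟨e.symm, fun x m => ?_, fun m => ?_⟩⟩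
  · obtain ⟨z, rfl⟩ := hS.counit_surjective hM m
    rw [← counit_act]
    exact (he _).trans (congrArg (M.Psi.LMinus.act x) (he z)).symm
  · obtain ⟨z, rfl⟩ := hS.counit_surjective hM m
    rw [← counit_par]
    exact (he _).trans (congrArg M.Psi.LMinus.par (he z)).symm

end WMod

end WInf

end

theorem mainTheorem2 (M : WInf.WMod.{u}) (hM : M.MemTWle) :
    (Nontrivial M.carrier → Nontrivial M.Psi.carrier) ∧
    (M.IsSimple →
      LieModule.IsIrreducible ℂ WInf.gl M.Psi.carrier ∧
      WInf.MemTgl M.Psi.carrier ∧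
      Nonempty (WInf.WMod.Iso M M.Psi.LMinus)) :=
  ⟨fun _ => WInf.WMod.nontrivial_Psi hM, fun hS =>
    ⟨hS.isIrreducible_Psi hM, WInf.WMod.memTgl_Psi hM (hS.isIrreducible_Psi hM),
      hS.nonempty_iso hM⟩⟩
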